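/- Theorem (density of the absorption time $A_0$). Let $0<\mu<\lambda$ and $0<\alpha<1$. Consider a particle moving on $[0,+\infty)$ with speed $1$, starting at the origin at time $0$. It moves upward during a random time $U_1$, then downward during a random time $D_1$, then upward during $U_2$, downward during $D_2$, and so on. If it reaches the origin during a downward period $D_j$, then it is absorbed there with probability $\alpha$; with probability $1-\alpha$ it is not absorbed, and in this case the remaining part of $D_j$ is discarded and the motion restarts at once upward, during the time $U_{j+1}$. The times $U_1,U_2,\dots$ are exponentially distributed with rate $\lambda$, the times $D_1,D_2,\dots$ are exponentially distributed with rate $\mu$, and all the $U_i$, all the $D_i$ and the decisions taken at the successive arrivals at the origin are mutually independent. Let $A_0$ be the time at which the particle is absorbed. Then $A_0$ is almost surely finite, and its law is absolutely continuous and concentrated on $(0,\infty)$, with a probability density $f_{A_0}$ given, for $y\in(0,\infty)$, by $$ f_{A_0}(y)=\alpha\,\frac{e^{-\frac{\lambda+\mu}{2}y}}{y}\Bigg\{\sqrt{\frac{\lambda}{\mu}}\;I_1\!\left(y\sqrt{\lambda\mu}\right)+\sum_{m=2}^{+\infty}\frac{(\lambda y/2)^m(1-\alpha)^{m-1}}{(m-1)\,(m-1)!}\bigg[2m\;{}_1F_2\!\left(\tfrac{m-1}{2};\tfrac{m+1}{2},m;\tfrac{\lambda\mu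 y^2}{4}\right)-(m+1)\;{}_1F_2\!\left(\tfrac{m-1}{2};\tfrac{m+1}{2},m+1;\tfrac{\lambda\mu y^2}{4}\right)\bigg]\Bigg\}, $$ where all the series converge and $f_{A_0}(y)=\frac{d}{dy}\mathbb P(A_0\le y)$ for every $y>0$. Here $$ I_n(z)=\left(\frac z2\right)^n\sum_{k=0}^{+\infty}\frac{(z^2/4)^k}{k!\,(k+n)!},\qquad {}_1F_2(a;b,c;z)=\sum_{n=0}^{+\infty}\frac{(a)_n}{(b)_n(c)_n}\,\frac{z^n}{n!}, $$ with $(d)_0=1$ and $(d)_n=d(d+1)\cdots(d+n-1)$ for $n\ge 1$. -/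

import Mathlib

open MeasureTheory ProbabilityTheory
open scoped ENNReal

/-- The modified Bessel function of the first kind of integer order `n`. -/
noncomputable def besselI (n : ℕ) (z : ℝ) : ℝ :=
  (z / 2) ^ n * ∑' k : ℕ, (z ^ 2 / 4) ^ k / (k.factorial * (k + n).factorial)

/-- The `n`-th term of the hypergeometric series `₁F₂(a; b, c; z)`; the rising factorial `(d)_n` is
`(ascPochhammer ℝ n).eval d`. -/
noncomputable def hyp1F2Term (a b c z : ℝ) (n : ℕ) : ℝ :=
  (ascPochhammer ℝ n).eval a / ((ascPochhammer ℝ n).eval b * (ascPochhammer ℝ n).eval c)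
    * (z ^ n / n.factorial)

/-- The hypergeometric function `₁F₂(a; b, c; z)`. -/
noncomputable def hyp1F2 (a b c z : ℝ) : ℝ :=
  ∑' n : ℕ, hyp1F2Term a b c z n

namespace ElasticTelegraph

/-! One trajectory of the elastic telegraph motion on `[0, ∞)` with speed one, started at `x`.
`u j` and `d j` are the lengths of the `j`-th upward and downward periods, and `b k` says whether the
`k`-th arrival at the origin leads to absorption; periods and arrivals are numbered from `0`.

The `j`-th leg of the motion is its `j`-th upward period followed by its `j`-th downward period.
The downward period is cut short when the particle reaches the origin; if the particle is not
absorbed there, the next leg begins at once. What follows is meaningful up to absorption. -/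

/-- The position of the particle at the beginning of the `j`-th leg: the particle goes up by `u j`,
then down by `d j`, stopping at the origin if it gets there. -/
def position (x : ℝ) (u d : ℕ → ℝ) : ℕ → ℝ
  | 0 => x
  | j + 1 => max (position x u d j + u j - d j) 0

/-- The particle reaches the origin during its `j`-th downward period. -/
def Arrives (x : ℝ) (u d : ℕ → ℝ) (j : ℕ) : Prop :=
  position x u d j + u j ≤ d j

/-- The time at which the `j`-th leg begins. A leg lasts `u j` plus the downward period `d j`,
truncated at the time `position j + u j` that the particle needs to get down to the origin. -/
def clock (x : ℝ) (u d : ℕ → ℝ) : ℕ → ℝ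
  | 0 => 0
  | j + 1 => clock x u d j + u j + min (d j) (position x u d j + u j)

open Classical in
/-- The number of arrivals at the origin before the `j`-th leg begins. -/
noncomputable def arrivals (x : ℝ) (u d : ℕ → ℝ) (j : ℕ) : ℕ :=
  Nat.count (Arrives x u d) j

/-- In its `j`-th leg the particle arrives at the origin, at an arrival that calls for absorption. -/
def HitsAbsorbing (x : ℝ) (u d : ℕ → ℝ) (b : ℕ → Bool) (j : ℕ) : Prop :=
  Arrives x u d j ∧ b (arrivals x u d j) = true

/-- The particle is absorbed at the end of its `j`-th leg (and was not absorbed before). -/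
def AbsorbedAt (x : ℝ) (u d : ℕ → ℝ) (b : ℕ → Bool) (j : ℕ) : Prop :=
  HitsAbsorbing x u d b j ∧ ∀ i < j, ¬ HitsAbsorbing x u d b i

/-- The time of absorption at the origin; it is `∞` if the particle is never absorbed. There is at
most one `j` with `AbsorbedAt x u d b j`. -/
noncomputable def absorptionTime (x : ℝ) (u d : ℕ → ℝ) (b : ℕ → Bool) : ℝ≥0∞ :=
  ⨅ (j : ℕ) (_ : AbsorbedAt x u d b j), ENNReal.ofReal (clock x u d (j + 1))

end ElasticTelegraph

/-- The summand of index `m` of the series in the density of the absorption time. -/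
noncomputable def absorptionSeriesTerm (lam μ α y : ℝ) (m : ℕ) : ℝ :=
  (lam * y / 2) ^ m * (1 - α) ^ (m - 1) / (((m : ℝ) - 1) * (m - 1).factorial) *
    (2 * m * hyp1F2 (((m : ℝ) - 1) / 2) (((m : ℝ) + 1) / 2) m (lam * μ * y ^ 2 / 4)
      - ((m : ℝ) + 1) *
        hyp1F2 (((m : ℝ) - 1) / 2) (((m : ℝ) + 1) / 2) ((m : ℝ) + 1) (lam * μ * y ^ 2 / 4))

/-- The density of the absorption time at `y > 0`; the series runs over `m = k + 2 ≥ 2`. -/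
noncomputable def absorptionDensity (lam μ α y : ℝ) : ℝ :=
  α * (Real.exp (-((lam + μ) / 2 * y)) / y) *
    (Real.sqrt (lam / μ) * besselI 1 (y * Real.sqrt (lam * μ))
      + ∑' k : ℕ, absorptionSeriesTerm lam μ α y (k + 2))

/-! The law of the absorption time and the measure with the stated density have the same Laplace
transform. Let φ(s) (`returnLaplace`) be the smaller root of μφ² − (λ+μ+2s)φ + λ = 0, the transform
of the first return time to the origin. Renewal at the returns, each absorbing with probability α,
suggests g = αφ/(1−(1−α)φ) (`absorptionLaplace`).

Probabilistic side: put r = s + μ(1−φ). The mean of e^{−s·clock} (1−α)^{arrivals} g e^{−r·position},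
plus the rewards collected for absorption, is conserved from leg to leg
(`lintegral_potential_succ`). Since n legs last at least n independent exponential times, the first
term dies out for s > 0, and the rewards sum to g (`tsum_lintegral_legReward`). The decisions are
independent of the periods, so averaging over them identifies these rewards with the contributions
of the legs to the true transform (`lintegral_absorbedAt`).

Analytic side: each bracket of hypergeometric functions collapses to a Bessel series
(`hasSum_hyp1F2_bracket`), so the density is an exponential times a double power series with
nonnegative coefficients (`absorptionDensity_eq`). Termwise integration produces ballot numbers,
whose generating functions are powers of the small root of C = 1 + wC² (`tsum_ballot_mul_pow`); what
remains is a geometric series with sum g (`lintegral_exp_mul_absorptionDensity`).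

Letting s → 0 gives almost sure finiteness, because φ(0) = 1 when μ < λ. The transforms at the
natural numbers determine the law, and continuity of the density on (0,∞) makes it the derivative of
the distribution function at every point. -/

/-! ### Power series form of the density -/

theorem ascPochhammer_eval_mul_add (a : ℝ) (n : ℕ) :
    (ascPochhammer ℝ n).eval a * (a + n) = a * (ascPochhammer ℝ n).eval (a + 1) := by
  rw [← ascPochhammer_succ_eval, ascPochhammer_succ_left]
  simp

theorem factorial_mul_ascPochhammer_eval (m n : ℕ) :
    (m.factorial : ℝ) * (ascPochhammer ℝ n).eval ((m : ℝ) + 1) = (n + m).factorial := by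
  induction n with
  | zero => simp
  | succ n ih =>
    rw [ascPochhammer_succ_eval, ← mul_assoc, ih, show n + 1 + m = (n + m) + 1 by ring,
      Nat.factorial_succ]
    push_cast
    ring

theorem one_le_ascPochhammer_eval {c : ℝ} (hc : 1 ≤ c) (n : ℕ) :
    1 ≤ (ascPochhammer ℝ n).eval c := by
  induction n with
  | zero => simp
  | succ n ih =>
    rw [ascPochhammer_succ_eval]
    exact one_le_mul_of_one_le_of_one_le ih (by linarith [(Nat.cast_nonneg n : (0 : ℝ) ≤ n)])

/-- The two rising factorials share all factors except the first of one and the last of the other.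
-/
theorem ascPochhammer_eval_div {a : ℝ} (ha : 0 < a) (n : ℕ) :
    (ascPochhammer ℝ n).eval a / (ascPochhammer ℝ n).eval (a + 1) = a / (a + n) := by
  have h := ascPochhammer_eval_mul_add a n
  have h1 : 0 < (ascPochhammer ℝ n).eval (a + 1) := ascPochhammer_pos n _ (by linarith)
  have h2 : 0 < a + n := by positivity
  rw [div_eq_div_iff h1.ne' h2.ne', h]

theorem hyp1F2Term_succ {a : ℝ} (ha : 0 < a) (c z : ℝ) (n : ℕ) :
    hyp1F2Term a (a + 1) c z n
      = a / (a + n) / (ascPochhammer ℝ n).eval c * (z ^ n / n.factorial) := by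
  rw [hyp1F2Term, ← div_div, ascPochhammer_eval_div ha]

theorem summable_hyp1F2Term {a c z : ℝ} (ha : 0 < a) (hc : 1 ≤ c) :
    Summable (hyp1F2Term a (a + 1) c z) := by
  refine (Real.summable_pow_div_factorial |z|).of_norm_bounded fun n => ?_
  have h1 := one_le_ascPochhammer_eval hc n
  have h2 : 0 < a + n := by positivity
  rw [hyp1F2Term_succ ha, norm_mul, Real.norm_of_nonneg (by positivity), norm_div, norm_pow,
    Real.norm_eq_abs z, Real.norm_of_nonneg (Nat.cast_nonneg _)]
  refine mul_le_of_le_one_left (by positivity) ?_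
  refine div_le_one_of_le₀ (le_trans ?_ h1) (by linarith)
  exact div_le_one_of_le₀ (by linarith [(Nat.cast_nonneg n : (0 : ℝ) ≤ n)]) h2.le

/-- For `m ≥ 2` the bracket in `absorptionSeriesTerm` is a multiple of a Bessel series. -/
theorem hasSum_hyp1F2_bracket (m : ℕ) (hm : 2 ≤ m) (z : ℝ) :
    HasSum (fun n : ℕ => ((m : ℝ) - 1) * (m - 1).factorial *
        (m * (z ^ n / (n.factorial * (n + m).factorial))))
      (2 * m * hyp1F2 (((m : ℝ) - 1) / 2) (((m : ℝ) + 1) / 2) m z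
      - ((m : ℝ) + 1) * hyp1F2 (((m : ℝ) - 1) / 2) (((m : ℝ) + 1) / 2) ((m : ℝ) + 1) z) := by
  obtain ⟨l, rfl⟩ := Nat.exists_eq_add_of_le' hm
  have e : (((l + 2 : ℕ) : ℝ) + 1) / 2 = (((l + 2 : ℕ) : ℝ) - 1) / 2 + 1 := by ring
  have hl : (0 : ℝ) ≤ l := Nat.cast_nonneg l
  have ha : 0 < (((l + 2 : ℕ) : ℝ) - 1) / 2 := by push_cast; linarith
  rw [e]
  have h := ((summable_hyp1F2Term (z := z) ha (c := ((l + 2 : ℕ) : ℝ))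
    (by push_cast; linarith)).hasSum.mul_left (2 * ((l + 2 : ℕ) : ℝ))).sub
    ((summable_hyp1F2Term (z := z) ha (c := ((l + 2 : ℕ) : ℝ) + 1)
      (by push_cast; linarith)).hasSum.mul_left (((l + 2 : ℕ) : ℝ) + 1))
  -- The identity holds term by term. With a = (m−1)/2, the common factor a/(a+n) is (m−1)/(m−1+2n),
  -- and 2m/(m)_n − (m+1)/(m+1)_n = (m−1+2n) m!/(n+m)!, so the factor m−1+2n cancels.
  refine (iff_of_eq (congrArg (fun f : ℕ → ℝ => HasSum f _) (funext fun n => ?_))).mp h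
  have f1 := factorial_mul_ascPochhammer_eval (l + 1) n
  have f2 := factorial_mul_ascPochhammer_eval (l + 2) n
  have c1 : ((l + 1 : ℕ) : ℝ) + 1 = ((l + 2 : ℕ) : ℝ) := by push_cast; ring
  rw [c1] at f1
  rw [show n + (l + 2) = (n + (l + 1)) + 1 by ring, Nat.factorial_succ (n + (l + 1)),
    show (l + 2).factorial = (l + 2) * (l + 1).factorial from rfl] at f2
  rw [hyp1F2Term_succ ha, hyp1F2Term_succ ha, show n + (l + 2) = (n + (l + 1)) + 1 by ring,
    Nat.factorial_succ (n + (l + 1)), show l + 2 - 1 = l + 1 by rfl]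
  have p1 : (0 : ℝ) < (l + 1).factorial := by positivity
  have p2 : (0 : ℝ) < (n + (l + 1)).factorial := by positivity
  have p3 : (0 : ℝ) < n.factorial := by positivity
  have g1 : (ascPochhammer ℝ n).eval ((l + 2 : ℕ) : ℝ)
      = (n + (l + 1)).factorial / (l + 1).factorial := by
    rw [eq_div_iff p1.ne', mul_comm, f1]
  have g2 : (ascPochhammer ℝ n).eval (((l + 2 : ℕ) : ℝ) + 1)
      = (n + l + 2) * (n + (l + 1)).factorial / ((l + 2) * (l + 1).factorial) := by
    rw [eq_div_iff (by positivity), mul_comm]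
    push_cast at f2 ⊢
    linarith
  rw [g1, g2]
  push_cast
  generalize ((n + (l + 1)).factorial : ℝ) = F at *
  generalize ((l + 1).factorial : ℝ) = G at *
  generalize (n.factorial : ℝ) = H at *
  have hn : (0 : ℝ) ≤ n := Nat.cast_nonneg n
  have q1 : (l : ℝ) + 1 + 2 * n ≠ 0 := by positivity
  rw [show ((l : ℝ) + 2 - 1) / 2 + n = (l + 1 + 2 * n) / 2 by ring]
  have q2 : (n : ℝ) + (l + 1) + 1 ≠ 0 := by positivity
  have q3 : (n : ℝ) + l + 2 ≠ 0 := by positivity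
  field_simp
  ring

/-- The coefficient of `y ^ (j + 2 * k)` in the power series of
`absorptionDensity lam μ α y * exp ((lam + μ) / 2 * y) / α`. -/
noncomputable def absorptionCoeff (lam μ α : ℝ) (q : ℕ × ℕ) : ℝ :=
  (1 - α) ^ q.1 * ((q.1 + 1) * (lam / 2) ^ (q.1 + 1)) *
    ((lam * μ / 4) ^ q.2 / (q.2.factorial * (q.2 + (q.1 + 1)).factorial))

theorem absorptionCoeff_nonneg {lam μ α : ℝ} (hl : 0 ≤ lam) (hμ : 0 ≤ μ) (hα : α ≤ 1)
    (q : ℕ × ℕ) : 0 ≤ absorptionCoeff lam μ α q := by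
  have : 0 ≤ 1 - α := by linarith
  unfold absorptionCoeff
  positivity

/-- Since (j+1)/(k+j+1)! ≤ 1/j!, the double series is dominated by a product of two exponential
series. -/
theorem summable_absorptionCoeff_mul_pow {lam μ α : ℝ} (hl : 0 ≤ lam) (hμ : 0 ≤ μ)
    (hα0 : 0 ≤ α) (hα : α ≤ 1) {y : ℝ} (hy : 0 ≤ y) :
    Summable fun q : ℕ × ℕ => absorptionCoeff lam μ α q * y ^ (q.1 + 2 * q.2) := by
  have h := ((Real.summable_pow_div_factorial (lam * y / 2)).mul_of_nonneg
    (Real.summable_pow_div_factorial (lam * μ * y ^ 2 / 4))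
    (fun _ => by positivity) (fun _ => by positivity)).mul_left (lam / 2)
  refine h.of_nonneg_of_le
    (fun q => mul_nonneg (absorptionCoeff_nonneg hl hμ hα q) (by positivity)) fun q => ?_
  obtain ⟨j, k⟩ := q
  simp only [absorptionCoeff]
  have e1 : (1 - α) ^ j ≤ 1 := pow_le_one₀ (by linarith) (by linarith)
  have e2 : ((j : ℝ) + 1) / (k + (j + 1)).factorial ≤ 1 / j.factorial := by
    rw [div_le_div_iff₀ (by positivity) (by positivity), one_mul]
    have := Nat.factorial_le (show j + 1 ≤ k + (j + 1) by omega)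
    rw [Nat.factorial_succ j] at this
    exact_mod_cast this
  calc _ = (1 - α) ^ j * (((j : ℝ) + 1) / (k + (j + 1)).factorial) *
        (lam / 2 * ((lam * y / 2) ^ j * ((lam * μ * y ^ 2 / 4) ^ k / k.factorial))) := by
        field_simp
        ring
    _ ≤ 1 * (1 / j.factorial) *
        (lam / 2 * ((lam * y / 2) ^ j * ((lam * μ * y ^ 2 / 4) ^ k / k.factorial))) := by
        gcongr
    _ = _ := by ring

theorem summable_pow_div_factorial_mul_factorial {z : ℝ} (m : ℕ) (hz : 0 ≤ z) :
    Summable fun k : ℕ => z ^ k / ((k.factorial : ℝ) * (k + m).factorial) := by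
  refine (Real.summable_pow_div_factorial z).of_nonneg_of_le (fun k => by positivity) fun k => ?_
  have : (1 : ℝ) ≤ (k + m).factorial := by exact_mod_cast Nat.factorial_pos _
  rw [← div_div]
  exact div_le_self (by positivity) this

theorem mul_tsum_absorptionCoeff_zero {lam μ : ℝ} (α : ℝ) (hl : 0 < lam) (hμ : 0 < μ) {y : ℝ} :
    y * ∑' k : ℕ, absorptionCoeff lam μ α (0, k) * y ^ (0 + 2 * k)
      = Real.sqrt (lam / μ) * besselI 1 (y * Real.sqrt (lam * μ)) := by
  have h1 : Real.sqrt (lam / μ) * Real.sqrt (lam * μ) = lam := by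
    rw [← Real.sqrt_mul (by positivity), show lam / μ * (lam * μ) = lam ^ 2 by field_simp,
      Real.sqrt_sq hl.le]
  rw [besselI, mul_pow y, Real.sq_sqrt (by positivity), pow_one,
    show ∀ S : ℝ, √(lam / μ) * (y * √(lam * μ) / 2 * S)
      = (√(lam / μ) * √(lam * μ)) * (y / 2) * S from fun S => by ring, h1,
    ← tsum_mul_left, ← tsum_mul_left]
  refine tsum_congr fun k => ?_
  simp only [absorptionCoeff]
  push_cast
  rw [pow_add, pow_mul]
  field_simp
  ring

theorem mul_tsum_absorptionCoeff_succ (lam μ α y : ℝ) (l : ℕ) :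
    y * ∑' k : ℕ, absorptionCoeff lam μ α (l + 1, k) * y ^ (l + 1 + 2 * k)
      = absorptionSeriesTerm lam μ α y (l + 2) := by
  rw [absorptionSeriesTerm, ← (hasSum_hyp1F2_bracket (l + 2) (by omega) _).tsum_eq,
    ← tsum_mul_left, ← tsum_mul_left]
  refine tsum_congr fun k => ?_
  simp only [absorptionCoeff]
  rw [show l + 2 - 1 = l + 1 by rfl]
  push_cast
  have p1 : (0 : ℝ) < (l + 1).factorial := by positivity
  have q1 : ((l : ℝ) + 2 - 1) ≠ 0 := by
    have : (0 : ℝ) < (l : ℝ) + 2 - 1 := by linarith [(Nat.cast_nonneg l : (0 : ℝ) ≤ l)]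
    exact this.ne'
  rw [show k + (l + 1 + 1) = k + (l + 2) by ring]
  field_simp
  ring

theorem summable_absorptionSeriesTerm {lam μ α : ℝ} (hl : 0 ≤ lam) (hμ : 0 ≤ μ)
    (hα0 : 0 ≤ α) (hα : α ≤ 1) {y : ℝ} (hy : 0 ≤ y) :
    Summable fun k : ℕ => absorptionSeriesTerm lam μ α y (k + 2) := by
  simp_rw [← mul_tsum_absorptionCoeff_succ]
  exact ((summable_nat_add_iff 1).mpr
    (summable_absorptionCoeff_mul_pow hl hμ hα0 hα hy).prod).mul_left y

/-- Sum the double series by rows: the row j = 0 is the Bessel term, and the row j ≥ 1 is the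
summand m = j + 1. The factor y of each row cancels the 1/y in the density. -/
theorem absorptionDensity_eq {lam μ α : ℝ} (hl : 0 < lam) (hμ : 0 < μ)
    (hα0 : 0 ≤ α) (hα : α ≤ 1) {y : ℝ} (hy : 0 < y) :
    absorptionDensity lam μ α y = α * Real.exp (-((lam + μ) / 2 * y)) *
      ∑' q : ℕ × ℕ, absorptionCoeff lam μ α q * y ^ (q.1 + 2 * q.2) := by
  have h := summable_absorptionCoeff_mul_pow hl.le hμ.le hα0 hα hy.le
  rw [absorptionDensity, h.tsum_prod, h.prod.tsum_eq_zero_add]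
  simp_rw [← mul_tsum_absorptionCoeff_succ]
  rw [← mul_tsum_absorptionCoeff_zero α hl hμ, tsum_mul_left]
  field_simp

theorem absorptionDensity_nonneg {lam μ α : ℝ} (hl : 0 < lam) (hμ : 0 < μ)
    (hα0 : 0 ≤ α) (hα : α ≤ 1) {y : ℝ} (hy : 0 < y) : 0 ≤ absorptionDensity lam μ α y := by
  rw [absorptionDensity_eq hl hμ hα0 hα hy]
  exact mul_nonneg (by positivity)
    (tsum_nonneg fun q => mul_nonneg (absorptionCoeff_nonneg hl.le hμ.le hα q) (by positivity))

theorem continuousOn_absorptionDensity {lam μ α : ℝ} (hl : 0 < lam) (hμ : 0 < μ)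
    (hα0 : 0 ≤ α) (hα : α ≤ 1) :
    ContinuousOn (absorptionDensity lam μ α) (Set.Ioi 0) := by
  refine ContinuousOn.congr (f := fun y => α * Real.exp (-((lam + μ) / 2 * y)) *
    ∑' q : ℕ × ℕ, absorptionCoeff lam μ α q * y ^ (q.1 + 2 * q.2)) ?_
    fun y hy => absorptionDensity_eq hl hμ hα0 hα hy
  refine (Continuous.continuousOn (by fun_prop)).mul ?_
  intro y hy
  rw [Set.mem_Ioi] at hy
  -- On (0, y+1) the values of the series at y + 1 dominate its terms, so convergence is uniform
  -- there.
  have : ContinuousOn (fun y => ∑' q : ℕ × ℕ, absorptionCoeff lam μ α q * y ^ (q.1 + 2 * q.2))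
      (Set.Ioo 0 (y + 1)) := by
    refine continuousOn_tsum (fun q => by fun_prop)
      (summable_absorptionCoeff_mul_pow hl.le hμ.le hα0 hα (y := y + 1) (by linarith))
      fun q x hx => ?_
    have hq := absorptionCoeff_nonneg hl.le hμ.le hα q
    have hx0 := hx.1.le
    rw [Real.norm_of_nonneg (by positivity)]
    exact mul_le_mul_of_nonneg_left (pow_le_pow_left₀ hx0 hx.2.le _) hq
  exact (this.continuousAt (Ioo_mem_nhds hy (by linarith))).continuousWithinAt

/-! ### Ballot numbers and their generating functions -/

/-- The ballot numbers `(j + 1) / (j + 2 k + 1) * (j + 2 k + 1).choose k`. -/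
noncomputable def ballot (j k : ℕ) : ℝ :=
  (j + 1) * (j + 2 * k).factorial / (k.factorial * (k + (j + 1)).factorial)

theorem ballot_nonneg (j k : ℕ) : 0 ≤ ballot j k := by unfold ballot; positivity

theorem ballot_zero_right (j : ℕ) : ballot j 0 = 1 := by
  have : (j.factorial : ℝ) ≠ 0 := by positivity
  simp only [ballot, mul_zero, add_zero, zero_add, Nat.factorial_succ]
  push_cast
  field_simp
  simp

theorem ballot_zero_succ (k : ℕ) : ballot 0 (k + 1) = ballot 1 k := by
  simp only [ballot]
  rw [show 0 + 2 * (k + 1) = (1 + 2 * k) + 1 by ring, show k + 1 + (0 + 1) = (k + 1) + 1 by ring,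
    show k + (1 + 1) = (k + 1) + 1 by ring]
  simp only [Nat.factorial_succ (1 + 2 * k), Nat.factorial_succ (k + 1), Nat.factorial_succ k]
  have : (k.factorial : ℝ) ≠ 0 := by positivity
  push_cast
  field_simp
  ring

/-- The coefficient form of C^{j+2} = C^{j+1} + w C^{j+3}, as `ballot_zero_succ` is that of C = 1 +
wC². -/
theorem ballot_succ_succ (j k : ℕ) :
    ballot (j + 1) (k + 1) = ballot j (k + 1) + ballot (j + 2) k := by
  simp only [ballot]
  rw [show j + 1 + 2 * (k + 1) = (j + 2 + 2 * k) + 1 by ring,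
    show j + 2 * (k + 1) = j + 2 + 2 * k by ring,
    show k + 1 + (j + 1 + 1) = (k + (j + 1)) + 1 + 1 by ring,
    show k + 1 + (j + 1) = (k + (j + 1)) + 1 by ring,
    show k + (j + 2 + 1) = (k + (j + 1)) + 1 + 1 by ring]
  simp only [Nat.factorial_succ (j + 2 + 2 * k), Nat.factorial_succ (k + (j + 1) + 1),
    Nat.factorial_succ (k + (j + 1)), Nat.factorial_succ k]
  have : (k.factorial : ℝ) ≠ 0 := by positivity
  have : ((k + (j + 1)).factorial : ℝ) ≠ 0 := by positivity
  push_cast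
  field_simp
  ring

/-- Comparison with a single binomial coefficient. The bound gives convergence for 4w < 1 and,
through its factor 2^j, the growth condition that singles out the small root in
`eq_pow_of_recurrence`. -/
theorem ballot_le (j k : ℕ) : ballot j k ≤ 2 ^ j * 4 ^ k := by
  have h1 : ballot j k ≤ (j + 2 * k).choose k := by
    have h := Nat.choose_mul_factorial_mul_factorial (show k ≤ j + 2 * k by omega)
    rw [show j + 2 * k - k = j + k by omega] at h
    have h' : ((j + 2 * k).choose k : ℝ) * k.factorial * (j + k).factorial
      = (j + 2 * k).factorial := by exact_mod_cast h
    rw [ballot, ← h', show k + (j + 1) = (j + k) + 1 by ring, Nat.factorial_succ,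
      div_le_iff₀ (by positivity)]
    push_cast
    have : (0 : ℝ) ≤ ((j + 2 * k).choose k : ℝ) * k.factorial * (j + k).factorial := by positivity
    nlinarith [mul_nonneg this (Nat.cast_nonneg k : (0 : ℝ) ≤ k)]
  have h2 : ((j + 2 * k).choose k : ℝ) ≤ 2 ^ (j + 2 * k) := by
    exact_mod_cast Nat.choose_le_two_pow _ _
  calc _ ≤ (2 : ℝ) ^ (j + 2 * k) := h1.trans h2
    _ = _ := by rw [pow_add, pow_mul]; norm_num

theorem summable_ballot_mul_pow {w : ℝ} (hw0 : 0 ≤ w) (hw : 4 * w < 1) (j : ℕ) :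
    Summable fun k => ballot j k * w ^ k := by
  have h := (summable_geometric_of_lt_one (r := 4 * w) (by linarith) hw).mul_left (2 ^ j)
  refine h.of_nonneg_of_le (fun k => mul_nonneg (ballot_nonneg j k) (by positivity)) fun k => ?_
  rw [mul_pow, ← mul_assoc]
  exact mul_le_mul_of_nonneg_right (ballot_le j k) (by positivity)

theorem tsum_ballot_le {w : ℝ} (hw0 : 0 ≤ w) (hw : 4 * w < 1) (j : ℕ) :
    ∑' k, ballot j k * w ^ k ≤ 2 ^ j * (1 - 4 * w)⁻¹ := by
  rw [← tsum_geometric_of_lt_one (r := 4 * w) (by linarith) hw, ← tsum_mul_left]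
  refine (summable_ballot_mul_pow hw0 hw j).tsum_le_tsum (fun k => ?_)
    ((summable_geometric_of_lt_one (r := 4 * w) (by linarith) hw).mul_left (2 ^ j))
  rw [mul_pow, ← mul_assoc]
  exact mul_le_mul_of_nonneg_right (ballot_le j k) (by positivity)

/-- A solution of `a n + w * a (n + 2) = a (n + 1)` that grows at most like `2 ^ n` is a multiple of
the geometric sequence belonging to the small root of `C = 1 + w * C ^ 2`. -/
theorem eq_pow_of_recurrence {a : ℕ → ℝ} {w C K : ℝ} (hwC0 : 0 < w * C) (hwC : w * C < 1 / 2)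
    (hC : C = 1 + w * C ^ 2) (ha : ∀ n, a (n + 1) = a n + w * a (n + 2)) (h0 : a 0 = 1)
    (hK : ∀ n, |a n| ≤ K * 2 ^ n) (n : ℕ) : a n = C ^ n := by
  -- The defect a(n+1) − C a(n) is multiplied by 1/(wC), the other root, at each step. As 1/(wC) >
  -- 2, growth of order 2^n forces the defect to vanish.
  have hstep : ∀ n, (w * C) * (a (n + 2) - C * a (n + 1)) = a (n + 1) - C * a n := fun n => by
    have := ha n
    linear_combination (-C) * this + (a (n + 1)) * hC
  have hpow : ∀ n, (w * C) ^ n * (a (n + 1) - C * a n) = a 1 - C * a 0 := fun n => by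
    induction n with
    | zero => simp
    | succ n ih => rw [pow_succ, mul_assoc, hstep, ih]
  have hlim : Filter.Tendsto (fun n : ℕ => (2 * (w * C)) ^ n * (K * (2 + |C|))) Filter.atTop
      (nhds (0 * (K * (2 + |C|)))) :=
    (tendsto_pow_atTop_nhds_zero_of_lt_one (by linarith) (by linarith)).mul_const _
  rw [zero_mul] at hlim
  have hle : |a 1 - C * a 0| ≤ 0 := by
    refine ge_of_tendsto' hlim fun n => ?_
    rw [← hpow n, abs_mul, abs_of_nonneg (by positivity), mul_pow 2, mul_comm ((2 : ℝ) ^ n),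
      mul_assoc ((w * C) ^ n)]
    refine mul_le_mul_of_nonneg_left ?_ (by positivity)
    calc |a (n + 1) - C * a n| ≤ |a (n + 1)| + |C * a n| := abs_sub _ _
      _ ≤ K * 2 ^ (n + 1) + |C| * (K * 2 ^ n) := by
        rw [abs_mul]
        exact add_le_add (hK _) (mul_le_mul_of_nonneg_left (hK n) (abs_nonneg _))
      _ = _ := by ring
  have hz : a 1 - C * a 0 = 0 := abs_eq_zero.mp (le_antisymm hle (abs_nonneg _))
  induction n with
  | zero => simpa using h0
  | succ n ih =>
    have := hpow n
    rw [hz] at this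
    have := (mul_eq_zero.mp this).resolve_left (by positivity)
    rw [pow_succ, ← ih]
    linarith

theorem tsum_ballot_mul_pow {w C : ℝ} (hw0 : 0 ≤ w) (hw : 4 * w < 1)
    (hwC0 : 0 < w * C) (hwC : w * C < 1 / 2) (hC : C = 1 + w * C ^ 2) (j : ℕ) :
    ∑' k, ballot j k * w ^ k = C ^ (j + 1) := by
  have hs := summable_ballot_mul_pow hw0 hw
  have hr0 : ∑' k, ballot 0 k * w ^ k = 1 + w * ∑' k, ballot 1 k * w ^ k := by
    rw [(hs 0).tsum_eq_zero_add, ballot_zero_right, ← tsum_mul_left]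
    simp only [pow_zero, mul_one, ballot_zero_succ]
    congr 1
    exact tsum_congr fun k => by ring
  have hr : ∀ j, ∑' k, ballot (j + 1) k * w ^ k
      = ∑' k, ballot j k * w ^ k + w * ∑' k, ballot (j + 2) k * w ^ k := fun j => by
    have h2 : Summable fun k => ballot j (k + 1) * w ^ (k + 1) := (summable_nat_add_iff 1).mpr (hs j)
    rw [(hs (j + 1)).tsum_eq_zero_add, (hs j).tsum_eq_zero_add, ballot_zero_right,
      ballot_zero_right, ← tsum_mul_left, add_assoc, ← h2.tsum_add ((hs (j + 2)).mul_left w)]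
    congr 1
    refine tsum_congr fun k => ?_
    rw [ballot_succ_succ]
    ring
  -- Prepending the value 1 = C^0 merges `hr0` and `hr` into one recurrence and shifts the exponent
  -- to j + 1.
  let a : ℕ → ℝ := fun n => Nat.casesOn n 1 fun j => ∑' k, ballot j k * w ^ k
  refine eq_pow_of_recurrence (a := a) (K := (1 - 4 * w)⁻¹) hwC0 hwC hC (fun n => ?_) rfl
    (fun n => ?_) (j + 1)
  · cases n with
    | zero => exact hr0
    | succ n => exact hr n
  · have h1 : 1 ≤ (1 - 4 * w)⁻¹ := (one_le_inv₀ (by linarith)).mpr (by linarith)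
    cases n with
    | zero => simpa [a] using h1
    | succ n =>
      have h2 : 0 ≤ ∑' k, ballot n k * w ^ k :=
        tsum_nonneg fun k => mul_nonneg (ballot_nonneg n k) (by positivity)
      refine (abs_of_nonneg h2).trans_le ((tsum_ballot_le hw0 hw n).trans ?_)
      rw [mul_comm, pow_succ]
      gcongr
      linarith [pow_pos (two_pos : (0 : ℝ) < 2) n]

/-! ### The root φ of the return equation -/

/-- The Laplace transform of the time of the first return to the origin. -/
noncomputable def returnLaplace (lam μ s : ℝ) : ℝ :=
  (lam + μ + 2 * s - Real.sqrt ((lam + μ + 2 * s) ^ 2 - 4 * lam * μ)) / (2 * μ)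

section returnLaplace

variable {lam μ s : ℝ}

theorem discr_pos (hμ : 0 < μ) (hl : μ < lam) (hs : 0 ≤ s) :
    0 < (lam + μ + 2 * s) ^ 2 - 4 * lam * μ := by
  nlinarith [sq_pos_of_pos (sub_pos.mpr hl)]

theorem returnLaplace_quadratic (hμ : 0 < μ) (hl : μ < lam) (hs : 0 ≤ s) :
    μ * returnLaplace lam μ s ^ 2 - (lam + μ + 2 * s) * returnLaplace lam μ s + lam = 0 := by
  have h := Real.sq_sqrt (discr_pos hμ hl hs).le
  unfold returnLaplace
  generalize √((lam + μ + 2 * s) ^ 2 - 4 * lam * μ) = R at h ⊢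
  field_simp
  linear_combination h

/-- This identifies φ as the smaller root; it becomes the condition wC < 1/2 for the ballot series.
-/
theorem two_mul_returnLaplace_lt (hμ : 0 < μ) (hl : μ < lam) (hs : 0 ≤ s) :
    2 * μ * returnLaplace lam μ s < lam + μ + 2 * s := by
  have h := Real.sqrt_pos.mpr (discr_pos hμ hl hs)
  rw [returnLaplace, mul_div_cancel₀ _ (by positivity)]
  linarith

theorem returnLaplace_pos (hμ : 0 < μ) (hl : μ < lam) (hs : 0 ≤ s) :
    0 < returnLaplace lam μ s := by
  have h1 := returnLaplace_quadratic hμ hl hs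
  have h2 : 0 < lam + μ + 2 * s := by linarith
  by_contra! hneg
  nlinarith [mul_nonneg hμ.le (sq_nonneg (returnLaplace lam μ s)),
    mul_nonneg h2.le (neg_nonneg.mpr hneg)]

/-- The square root is λ − μ rather than μ − λ because μ < λ: the drift is downward and return is
certain. -/
theorem returnLaplace_zero (hμ : 0 < μ) (hl : μ < lam) : returnLaplace lam μ 0 = 1 := by
  rw [returnLaplace, show (lam + μ + 2 * 0) ^ 2 - 4 * lam * μ = (lam - μ) ^ 2 by ring,
    Real.sqrt_sq (by linarith)]
  field_simp
  ring

theorem returnLaplace_le_one (hμ : 0 < μ) (hs : 0 ≤ s) :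
    returnLaplace lam μ s ≤ 1 := by
  rw [returnLaplace, div_le_one (by positivity)]
  suffices lam - μ + 2 * s ≤ √((lam + μ + 2 * s) ^ 2 - 4 * lam * μ) by linarith
  apply Real.le_sqrt_of_sq_le
  nlinarith [mul_nonneg hμ.le hs]

theorem continuous_returnLaplace : Continuous (returnLaplace lam μ) := by
  unfold returnLaplace
  fun_prop

end returnLaplace

/-! ### Laplace transform of the density -/

/-- The Laplace transform of the absorption time. -/
noncomputable def absorptionLaplace (lam μ α s : ℝ) : ℝ :=
  α * returnLaplace lam μ s / (1 - (1 - α) * returnLaplace lam μ s)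

theorem lintegral_pow_mul_exp {r : ℝ} (hr : 0 < r) (n : ℕ) :
    ∫⁻ y in Set.Ioi (0 : ℝ), ENNReal.ofReal (y ^ n * Real.exp (-(r * y)))
      = ENNReal.ofReal (n.factorial / r ^ (n + 1)) := by
  have h := Real.integral_rpow_mul_exp_neg_mul_Ioi (a := n + 1) (by positivity) hr
  rw [Real.Gamma_nat_eq_factorial, add_sub_cancel_right] at h
  simp_rw [Real.rpow_natCast] at h
  have e : (1 / r) ^ ((n : ℝ) + 1) * (n.factorial : ℝ) = n.factorial / r ^ (n + 1) := by
    rw [show (n : ℝ) + 1 = ((n + 1 : ℕ) : ℝ) by push_cast; rfl, Real.rpow_natCast, one_div, inv_pow]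
    field_simp
  rw [e] at h
  rw [← h, ofReal_integral_eq_lintegral_ofReal]
  -- Integrability is read off the value: a non-integrable function would have integral 0, but the
  -- value is positive.
  · by_contra hc
    rw [integral_undef hc] at h
    have : 0 < (n.factorial : ℝ) / r ^ (n + 1) := by positivity
    linarith
  · filter_upwards [self_mem_ae_restrict measurableSet_Ioi] with y hy
    have := (Set.mem_Ioi.mp hy).le
    positivity

theorem lintegral_exp_mul_absorptionDensity {lam μ α s : ℝ} (hμ : 0 < μ) (hl : μ < lam)
    (hα0 : 0 < α) (hα : α ≤ 1) (hs : 0 ≤ s) :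
    ∫⁻ y in Set.Ioi (0 : ℝ), ENNReal.ofReal (Real.exp (-(s * y)) * absorptionDensity lam μ α y)
      = ENNReal.ofReal (absorptionLaplace lam μ α s) := by
  have hlam : 0 < lam := hμ.trans hl
  set p := lam + μ + 2 * s with hp
  have hp0 : 0 < p := by positivity
  set φ := returnLaplace lam μ s with hφ
  have φ0 : 0 < φ := returnLaplace_pos hμ hl hs
  have φ1 : φ ≤ 1 := returnLaplace_le_one hμ hs
  have hquad : μ * φ ^ 2 - p * φ + lam = 0 := returnLaplace_quadratic hμ hl hs
  have hnn : ∀ q, 0 ≤ absorptionCoeff lam μ α q := absorptionCoeff_nonneg hlam.le hμ.le hα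
  have step1 : ∀ y ∈ Set.Ioi (0 : ℝ),
      ENNReal.ofReal (Real.exp (-(s * y)) * absorptionDensity lam μ α y)
      = ∑' q : ℕ × ℕ, ENNReal.ofReal (α * absorptionCoeff lam μ α q) *
        ENNReal.ofReal (y ^ (q.1 + 2 * q.2) * Real.exp (-(p / 2 * y))) := fun y hy => by
    have hy' := Set.mem_Ioi.mp hy
    rw [absorptionDensity_eq hlam hμ hα0.le hα hy', ← mul_assoc, ← tsum_mul_left,
      ENNReal.ofReal_tsum_of_nonneg]
    · refine tsum_congr fun q => ?_
      rw [← ENNReal.ofReal_mul (mul_nonneg hα0.le (hnn q)), show -(p / 2 * y)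
        = -(s * y) + -((lam + μ) / 2 * y) by rw [hp]; ring, Real.exp_add]
      congr 1
      ring
    · exact fun q => mul_nonneg (by positivity) (mul_nonneg (hnn q) (by positivity))
    · exact (summable_absorptionCoeff_mul_pow hlam.le hμ.le hα0.le hα hy'.le).mul_left _
  rw [setLIntegral_congr_fun measurableSet_Ioi step1, lintegral_tsum fun q => by fun_prop]
  have hw : 4 * (lam * μ / p ^ 2) < 1 := by
    rw [← mul_div_assoc, div_lt_one (by positivity)]
    linarith [discr_pos hμ hl hs]
  -- With w = λμ/p² and C = pφ/λ, the quadratic equation for φ reads C = 1 + wC², and wC = μφ/p.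
  have hC : ∀ j, ∑' k, ballot j k * (lam * μ / p ^ 2) ^ k = (p * φ / lam) ^ (j + 1) := by
    have e : lam * μ / p ^ 2 * (p * φ / lam) = μ * φ / p := by field_simp
    refine tsum_ballot_mul_pow (by positivity) hw (by positivity) ?_ ?_
    · rw [e, div_lt_iff₀ hp0]
      linarith [two_mul_returnLaplace_lt hμ hl hs]
    · field_simp
      linear_combination -hquad
  have step2 : ∀ q : ℕ × ℕ,
      ∫⁻ y in Set.Ioi (0 : ℝ), ENNReal.ofReal (α * absorptionCoeff lam μ α q) *
        ENNReal.ofReal (y ^ (q.1 + 2 * q.2) * Real.exp (-(p / 2 * y)))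
      = ENNReal.ofReal (α * (1 - α) ^ q.1 * (lam / p) ^ (q.1 + 1) *
        (ballot q.1 q.2 * (lam * μ / p ^ 2) ^ q.2)) := fun q => by
    -- The gamma integral contributes (j+2k)!, which completes the coefficient to a ballot number.
    rw [lintegral_const_mul _ (by fun_prop), lintegral_pow_mul_exp (by positivity),
      ← ENNReal.ofReal_mul (mul_nonneg hα0.le (hnn q))]
    congr 1
    simp only [absorptionCoeff, ballot, div_pow, pow_add, pow_mul, mul_pow]
    have : (4 : ℝ) ^ q.2 = (2 ^ 2) ^ q.2 := by norm_num
    field_simp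
    rw [this]
  simp_rw [step2]
  have α1 : 0 ≤ 1 - α := by linarith
  have hlt : (1 - α) * φ < 1 := by nlinarith
  rw [ENNReal.tsum_prod']
  have step3 : ∀ j : ℕ, ∑' k, ENNReal.ofReal (α * (1 - α) ^ j * (lam / p) ^ (j + 1) *
      (ballot j k * (lam * μ / p ^ 2) ^ k)) = ENNReal.ofReal (α * φ * ((1 - α) * φ) ^ j) := by
    intro j
    rw [← ENNReal.ofReal_tsum_of_nonneg
      (fun k => mul_nonneg (by positivity) (mul_nonneg (ballot_nonneg j k) (by positivity)))
      ((summable_ballot_mul_pow (by positivity) hw j).mul_left _), tsum_mul_left, hC]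
    congr 1
    rw [div_pow, div_pow, mul_pow (1 - α)]
    field_simp
    ring_nf
  simp only [step3]
  rw [← ENNReal.ofReal_tsum_of_nonneg (fun j => by positivity)
    ((summable_geometric_of_lt_one (by positivity) hlt).mul_left _), tsum_mul_left,
    tsum_geometric_of_lt_one (by positivity) hlt]
  rfl

/-! ### Exponential integrals over one leg -/

theorem lintegral_expMeasure {r : ℝ} (f : ℝ → ℝ≥0∞) :
    ∫⁻ x, f x ∂(expMeasure r)
      = ∫⁻ x in Set.Ioi (0 : ℝ), ENNReal.ofReal (r * Real.exp (-(r * x))) * f x := by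
  have h : ∀ x, exponentialPDF r x
      = (Set.Ici (0 : ℝ)).indicator (fun x => ENNReal.ofReal (r * Real.exp (-(r * x)))) x := by
    intro x
    rw [exponentialPDF_eq, Set.indicator_apply]
    simp only [Set.mem_Ici]
    split_ifs <;> simp
  have hm : Measurable (exponentialPDF r) := by
    rw [funext h]
    exact Measurable.indicator (by fun_prop) measurableSet_Ici
  rw [expMeasure, gammaMeasure, show gammaPDF 1 r = exponentialPDF r from rfl,
    lintegral_withDensity_eq_lintegral_mul_non_measurable _ hm
      (Filter.Eventually.of_forall fun x => by simp [exponentialPDF]),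
    setLIntegral_congr Ioi_ae_eq_Ici, ← lintegral_indicator measurableSet_Ici]
  refine lintegral_congr fun x => ?_
  simp only [Pi.mul_apply, h, Set.indicator_apply]
  split_ifs <;> simp

theorem lintegral_exp_neg_Ioi {a : ℝ} (ha : 0 < a) (z : ℝ) :
    ∫⁻ x in Set.Ioi z, ENNReal.ofReal (Real.exp (-(a * x)))
      = ENNReal.ofReal (Real.exp (-(a * z)) / a) := by
  simp_rw [← neg_mul]
  rw [← ofReal_integral_eq_lintegral_ofReal (integrableOn_exp_mul_Ioi (by linarith) z)
    (Filter.Eventually.of_forall fun x => (Real.exp_pos _).le), integral_exp_mul_Ioi (by linarith)]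
  rw [neg_div_neg_eq]

theorem lintegral_exp_neg_Ioo {a z : ℝ} (ha : 0 < a) (hz : 0 ≤ z) :
    ∫⁻ x in Set.Ioo 0 z, ENNReal.ofReal (Real.exp (-(a * x)))
      = ENNReal.ofReal ((1 - Real.exp (-(a * z))) / a) := by
  have h0 := lintegral_exp_neg_Ioi ha 0
  have hz' := lintegral_exp_neg_Ioi ha z
  rw [← Set.Ioc_union_Ioi_eq_Ioi hz, lintegral_union measurableSet_Ioi
    (Set.disjoint_left.mpr fun x hx hx' => not_lt.mpr hx.2 hx'), hz'] at h0
  rw [setLIntegral_congr Ioo_ae_eq_Ioc, ENNReal.eq_sub_of_add_eq ENNReal.ofReal_ne_top h0,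
    ← ENNReal.ofReal_sub _ (by positivity)]
  simp [sub_div]

section OneLeg

variable {lam μ α s : ℝ}

theorem absorptionLaplace_denom_pos (hμ : 0 < μ) (hl : μ < lam) (hα0 : 0 < α)
    (hs : 0 ≤ s) : 0 < 1 - (1 - α) * returnLaplace lam μ s := by
  have h0 := returnLaplace_pos hμ hl hs
  have h1 := returnLaplace_le_one (lam := lam) hμ hs
  nlinarith

theorem absorptionLaplace_pos (hμ : 0 < μ) (hl : μ < lam) (hα0 : 0 < α)
    (hs : 0 ≤ s) : 0 < absorptionLaplace lam μ α s :=
  div_pos (mul_pos hα0 (returnLaplace_pos hμ hl hs))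
    (absorptionLaplace_denom_pos hμ hl hα0 hs)

/-- Renewal at the first return: the transform φ of the return time multiplies the reward α for
absorption plus (1−α)g for restarting from the origin. -/
theorem absorptionLaplace_eq (hμ : 0 < μ) (hl : μ < lam) (hα0 : 0 < α)
    (hs : 0 ≤ s) : absorptionLaplace lam μ α s
      = returnLaplace lam μ s * (α + (1 - α) * absorptionLaplace lam μ α s) := by
  have := (absorptionLaplace_denom_pos hμ hl hα0 hs).ne'
  unfold absorptionLaplace
  generalize returnLaplace lam μ s = φ at *
  rw [div_eq_iff this, mul_assoc, add_mul, mul_assoc (1 - α), div_mul_cancel₀ _ this]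
  ring

/-- The Laplace transform of the time needed to go down by `z` is `exp (-(descentRate * z))`. -/
noncomputable def descentRate (lam μ s : ℝ) : ℝ :=
  s + μ * (1 - returnLaplace lam μ s)

theorem descentRate_nonneg (hμ : 0 < μ) (hs : 0 ≤ s) : 0 ≤ descentRate lam μ s := by
  have h1 := returnLaplace_le_one (lam := lam) hμ hs
  unfold descentRate
  nlinarith

/-- One downward period from height `z`, with the reward `κ` for reaching the origin. -/
theorem lintegral_downward (hμ : 0 < μ) (hl : μ < lam) (hs : 0 ≤ s) {κ z : ℝ} (hκ : 0 ≤ κ)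
    (hz : 0 ≤ z) :
    ∫⁻ d, ENNReal.ofReal (if z ≤ d then Real.exp (-(s * z)) * κ else
      Real.exp (-(s * d)) * (returnLaplace lam μ s * κ *
        Real.exp (-(descentRate lam μ s * (z - d))))) ∂(expMeasure μ)
      = ENNReal.ofReal (κ * Real.exp (-(descentRate lam μ s * z))) := by
  set φ := returnLaplace lam μ s with hφ
  have φ0 : 0 < φ := returnLaplace_pos hμ hl hs
  set r := descentRate lam μ s with hr
  have hr' : r = s + μ * (1 - φ) := rfl
  rw [lintegral_expMeasure, setLIntegral_congr Ioi_ae_eq_Ici, ← Set.Ico_union_Ici_eq_Ici hz,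
    lintegral_union measurableSet_Ici
    (Set.disjoint_left.mpr fun x hx hx' => not_lt.mpr hx' hx.2),
    setLIntegral_congr Ioo_ae_eq_Ico.symm, setLIntegral_congr Ioi_ae_eq_Ici.symm]
  have e1 : ∀ d ∈ Set.Ioo 0 z, ENNReal.ofReal (μ * Real.exp (-(μ * d))) *
      ENNReal.ofReal (if z ≤ d then Real.exp (-(s * z)) * κ else
        Real.exp (-(s * d)) * (φ * κ * Real.exp (-(r * (z - d)))))
      = ENNReal.ofReal (μ * φ * κ * Real.exp (-(r * z))) *
        ENNReal.ofReal (Real.exp (-(μ * φ * d))) := fun d hd => by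
    rw [if_neg (not_le.mpr hd.2), ← ENNReal.ofReal_mul (by positivity),
      ← ENNReal.ofReal_mul (by positivity)]
    congr 1
    rw [show -(μ * φ * d) = -(μ * d) + -(s * d) + -(r * (z - d)) + r * z by rw [hr']; ring,
      Real.exp_add, Real.exp_add, Real.exp_add, Real.exp_neg (r * z)]
    field_simp
  have e2 : ∀ d ∈ Set.Ioi z, ENNReal.ofReal (μ * Real.exp (-(μ * d))) *
      ENNReal.ofReal (if z ≤ d then Real.exp (-(s * z)) * κ else
        Real.exp (-(s * d)) * (φ * κ * Real.exp (-(r * (z - d)))))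
      = ENNReal.ofReal (μ * κ * Real.exp (-(s * z))) *
        ENNReal.ofReal (Real.exp (-(μ * d))) := fun d hd => by
    rw [if_pos (Set.mem_Ioi.mp hd).le, ← ENNReal.ofReal_mul (by positivity),
      ← ENNReal.ofReal_mul (by positivity)]
    congr 1
    ring
  have hE : Real.exp (-(μ * φ * z)) ≤ 1 := Real.exp_le_one_iff.mpr (by
    have : 0 ≤ μ * φ * z := by positivity
    linarith)
  rw [setLIntegral_congr_fun measurableSet_Ioo e1, setLIntegral_congr_fun measurableSet_Ioi e2,
    lintegral_const_mul _ (by fun_prop), lintegral_const_mul _ (by fun_prop),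
    lintegral_exp_neg_Ioo (by positivity) hz, lintegral_exp_neg_Ioi hμ,
    ← ENNReal.ofReal_mul (by positivity), ← ENNReal.ofReal_mul (by positivity),
    ← ENNReal.ofReal_add (mul_nonneg (by positivity) (div_nonneg (by linarith) (by positivity)))
      (by positivity)]
  congr 1
  -- The boundary term of the integral over d < z cancels the contribution of d ≥ z, because s + μ =
  -- r + μφ by the choice of r.
  have h3 : Real.exp (-(s * z)) * Real.exp (-(μ * z))
      = Real.exp (-(r * z)) * Real.exp (-(μ * φ * z)) := by
    rw [← Real.exp_add, ← Real.exp_add, hr']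
    congr 1
    ring
  generalize Real.exp (-(s * z)) = a at h3 ⊢
  generalize Real.exp (-(μ * z)) = b at h3 ⊢
  generalize Real.exp (-(r * z)) = c at h3 ⊢
  generalize Real.exp (-(μ * φ * z)) = e at h3 ⊢
  field_simp
  linear_combination κ * h3

/-- An upward period followed by a descent to the origin. -/
theorem lintegral_upward (hμ : 0 < μ) (hl : μ < lam) (hs : 0 ≤ s) {κ : ℝ} (hκ : 0 ≤ κ) (x : ℝ) :
    ∫⁻ u, ENNReal.ofReal (Real.exp (-(s * u)) *
      (κ * Real.exp (-(descentRate lam μ s * (x + u))))) ∂(expMeasure lam)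
      = ENNReal.ofReal (returnLaplace lam μ s * κ * Real.exp (-(descentRate lam μ s * x))) := by
  have hr := descentRate_nonneg (lam := lam) hμ hs
  have hquad := returnLaplace_quadratic hμ hl hs
  set r := descentRate lam μ s with hr0
  set φ := returnLaplace lam μ s with hφ
  have hr' : r = s + μ * (1 - φ) := rfl
  have hlam : 0 < lam := hμ.trans hl
  rw [lintegral_expMeasure]
  have e : ∀ u, ENNReal.ofReal (lam * Real.exp (-(lam * u))) *
      ENNReal.ofReal (Real.exp (-(s * u)) * (κ * Real.exp (-(r * (x + u)))))
      = ENNReal.ofReal (lam * κ * Real.exp (-(r * x))) *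
        ENNReal.ofReal (Real.exp (-((lam + s + r) * u))) := fun u => by
    rw [← ENNReal.ofReal_mul (by positivity), ← ENNReal.ofReal_mul (by positivity)]
    congr 1
    rw [show -((lam + s + r) * u) = -(lam * u) + -(s * u) + (-(r * (x + u)) + r * x) by ring,
      Real.exp_add, Real.exp_add, Real.exp_add, Real.exp_neg (r * x)]
    field_simp
  simp_rw [e]
  rw [lintegral_const_mul _ (by fun_prop), lintegral_exp_neg_Ioi (by positivity),
    ← ENNReal.ofReal_mul (by positivity)]
  congr 1
  -- This is the quadratic equation for φ, once r is expanded.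
  have : φ * (lam + s + r) = lam := by rw [hr']; linear_combination (-1) * hquad
  have hpos : 0 < lam + s + r := by positivity
  rw [mul_zero, neg_zero, Real.exp_zero, mul_one_div, div_eq_iff hpos.ne']
  linear_combination (-(κ * Real.exp (-(r * x)))) * this

end OneLeg

/-! ### Structure of the trajectories and independence of the legs -/

/-- Puts the independence of the two sequences of periods in the indexed form needed to glue them
into one independent family over `Bool × ℕ`. -/
theorem ProbabilityTheory.IndepFun.iIndepFun_bool {Ω β : Type*} [MeasurableSpace Ω]
    [MeasurableSpace β] {P : Measure Ω} [IsProbabilityMeasure P] {X : Bool → Ω → β}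
    (h : IndepFun (X true) (X false) P) : iIndepFun X P := by
  rw [iIndepFun_iff_measure_inter_preimage_eq_mul]
  intro S sets hsets
  have h' := (indepFun_iff_measure_inter_preimage_eq_mul).mp h
  by_cases ht : true ∈ S <;> by_cases hf : false ∈ S
  · have : S = {true, false} := by ext b; cases b <;> simp [ht, hf]
    subst this
    rw [Finset.prod_pair (by simp), Finset.set_biInter_insert, Finset.set_biInter_singleton]
    exact h' _ _ (hsets _ ht) (hsets _ hf)
  · have : S = {true} := by ext b; cases b <;> simp [ht, hf]
    simp [this]
  · have : S = {false} := by ext b; cases b <;> simp [ht, hf]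
    simp [this]
  · have : S = ∅ := by ext b; cases b <;> simp [ht, hf]
    simp [this]

namespace ElasticTelegraph

theorem position_nonneg {x : ℝ} (hx : 0 ≤ x) (u d : ℕ → ℝ) (j : ℕ) : 0 ≤ position x u d j := by
  cases j with
  | zero => exact hx
  | succ j => exact le_max_right _ _

theorem clock_nonneg {x : ℝ} (hx : 0 ≤ x) {u d : ℕ → ℝ} (hu : ∀ i, 0 ≤ u i) (hd : ∀ i, 0 ≤ d i)
    (j : ℕ) : 0 ≤ clock x u d j := by
  induction j with
  | zero => exact le_rfl
  | succ j ih =>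
    exact add_nonneg (add_nonneg ih (hu j))
      (le_min (hd j) (add_nonneg (position_nonneg hx u d j) (hu j)))

open Classical in
theorem arrivals_succ (x : ℝ) (u d : ℕ → ℝ) (j : ℕ) :
    arrivals x u d (j + 1) = arrivals x u d j + if position x u d j + u j ≤ d j then 1 else 0 :=
  Nat.count_succ _ _

/-- Decisions are consumed one per arrival, so survival up to leg j means that all decisions used so
far are negative. Absorption thus depends on the decisions only through the index of the first
positive one. -/
theorem absorbedAt_iff (x : ℝ) (u d : ℕ → ℝ) (b : ℕ → Bool) (j : ℕ) :
    AbsorbedAt x u d b j ↔ Arrives x u d j ∧ b (arrivals x u d j) = true ∧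
      ∀ k < arrivals x u d j, b k = false := by
  have h : ∀ j, (∀ i < j, ¬ HitsAbsorbing x u d b i) ↔
      ∀ k < arrivals x u d j, b k = false := by
    intro j
    induction j with
    | zero => simp [arrivals]
    | succ j ih =>
      rw [Nat.forall_lt_succ_right, ih, arrivals_succ]
      by_cases ha : position x u d j + u j ≤ d j
      · rw [if_pos ha, Nat.forall_lt_succ_right]
        have : Arrives x u d j := ha
        simp [HitsAbsorbing, this]
      · rw [if_neg ha, add_zero]
        have : ¬ Arrives x u d j := ha
        simp [HitsAbsorbing, this]
  rw [AbsorbedAt, h, HitsAbsorbing, and_assoc]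

theorem AbsorbedAt.unique {x : ℝ} {u d : ℕ → ℝ} {b : ℕ → Bool} {i j : ℕ}
    (hi : AbsorbedAt x u d b i) (hj : AbsorbedAt x u d b j) : i = j := by
  rcases lt_trichotomy i j with h | h | h
  · exact absurd hi.1 (hj.2 i h)
  · exact h
  · exact absurd hj.1 (hi.2 j h)

theorem AbsorbedAt.absorptionTime_eq {x : ℝ} {u d : ℕ → ℝ} {b : ℕ → Bool} {j : ℕ}
    (hj : AbsorbedAt x u d b j) :
    absorptionTime x u d b = ENNReal.ofReal (clock x u d (j + 1)) := by
  refine le_antisymm (iInf₂_le j hj) (le_iInf₂ fun i hi => ?_)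
  rw [hi.unique hj]

/-- The position, the clock and the number of arrivals at the beginning of a leg. -/
noncomputable def state (x : ℝ) (u d : ℕ → ℝ) (j : ℕ) : ℝ × ℝ × ℕ :=
  (position x u d j, clock x u d j, arrivals x u d j)

open Classical in
theorem state_succ (x : ℝ) (u d : ℕ → ℝ) (j : ℕ) :
    state x u d (j + 1) = (max ((state x u d j).1 + u j - d j) 0,
      (state x u d j).2.1 + u j + min (d j) ((state x u d j).1 + u j),
      (state x u d j).2.2 + if (state x u d j).1 + u j ≤ d j then 1 else 0) := by
  simp only [state, arrivals_succ]
  rfl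

/-- Only periods with index below n are required to be measurable, and the σ-algebra is arbitrary;
this lets `indepFun_state` use the σ-algebra generated by the past. -/
theorem measurable_state {T : Type*} {mT : MeasurableSpace T} {u d : T → ℕ → ℝ} (x : ℝ) (n : ℕ)
    (hu : ∀ i < n, Measurable fun t => u t i) (hd : ∀ i < n, Measurable fun t => d t i) :
    Measurable fun t => state x (u t) (d t) n := by
  induction n with
  | zero =>
    have : (fun t => state x (u t) (d t) 0) = fun _ => (x, 0, 0) := by
      ext t <;> simp [state, position, clock, arrivals]
    rw [this]
    exact measurable_const
  | succ n ih =>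
    have h := ih (fun i hi => hu i (by omega)) fun i hi => hd i (by omega)
    have hun := hu n (by omega)
    have hdn := hd n (by omega)
    simp only [state_succ]
    have h1 : Measurable fun t => (state x (u t) (d t) n).1 := h.fst
    have h2 : Measurable fun t => (state x (u t) (d t) n).2.1 := h.snd.fst
    have h3 : Measurable fun t => (state x (u t) (d t) n).2.2 := h.snd.snd
    refine ((h1.add hun).sub hdn).max measurable_const |>.prodMk
      (((h2.add hun).add (hdn.min (h1.add hun))).prodMk (h3.add ?_))
    exact Measurable.ite (measurableSet_le (h1.add hun) hdn) measurable_const measurable_const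

section Independence

variable {Ω : Type*} [MeasurableSpace Ω] {P : Measure Ω} [IsProbabilityMeasure P]
  {U D : ℕ → Ω → ℝ}

/-- The state uses periods of index below n, the leg those of index n: disjoint blocks of one
independent family. -/
theorem indepFun_state (hU_meas : ∀ i, Measurable (U i)) (hD_meas : ∀ i, Measurable (D i))
    (hU_indep : iIndepFun U P) (hD_indep : iIndepFun D P)
    (hUD_indep : IndepFun (fun ω i => U i ω) (fun ω i => D i ω) P) (x : ℝ) (n : ℕ) :
    IndepFun (fun ω => state x (fun i => U i ω) (fun i => D i ω) n)
      (fun ω => (U n ω, D n ω)) P := by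
  let X : Bool → ℕ → Ω → ℝ := fun b => cond b U D
  have hX : ∀ b i, Measurable (X b i) := fun b i => by
    cases b
    · exact hD_meas i
    · exact hU_meas i
  have hindep : iIndepFun (fun (p : Bool × ℕ) ω => X p.1 p.2 ω) P := by
    refine iIndepFun_uncurry' hX ?_ fun b => ?_
    · exact IndepFun.iIndepFun_bool hUD_indep
    · cases b
      · exact hD_indep
      · exact hU_indep
  have hind := indep_iSup_of_disjoint (fun p => (hX p.1 p.2).comap_le) hindep.iIndep
    (S := {p : Bool × ℕ | p.2 < n}) (T := {p : Bool × ℕ | p.2 = n})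
    (Set.disjoint_left.mpr fun p hp hp' => (ne_of_lt hp) hp')
  have key : ∀ (S : Set (Bool × ℕ)) (p : Bool × ℕ), p ∈ S →
      Measurable[⨆ p ∈ S, MeasurableSpace.comap (fun ω => X p.1 p.2 ω) inferInstance]
        (X p.1 p.2) := fun S p hp =>
    (comap_measurable (X p.1 p.2)).mono
      (le_iSup₂_of_le (f := fun p (_ : p ∈ S) => MeasurableSpace.comap (X p.1 p.2) _) p hp le_rfl)
      le_rfl
  rw [IndepFun_iff_Indep]
  refine indep_of_indep_of_le_left (indep_of_indep_of_le_right hind ?_) ?_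
  · exact measurable_iff_comap_le.mp
      ((key {p | p.2 = n} (true, n) rfl).prodMk (key {p | p.2 = n} (false, n) rfl))
  · exact measurable_iff_comap_le.mp
      (measurable_state x n (fun i hi => key {p | p.2 < n} (true, i) hi)
        fun i hi => key {p | p.2 < n} (false, i) hi)

/-- The Markov property in integrated form: by Fubini, the current leg may be averaged with the
state held fixed. -/
theorem lintegral_state_leg {lam μ : ℝ} (hlam : 0 < lam) (hμ : 0 < μ)
    (hU_meas : ∀ i, Measurable (U i)) (hD_meas : ∀ i, Measurable (D i))
    (hU_law : ∀ i, P.map (U i) = expMeasure lam) (hD_law : ∀ i, P.map (D i) = expMeasure μ)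
    (hU_indep : iIndepFun U P) (hD_indep : iIndepFun D P)
    (hUD_indep : IndepFun (fun ω i => U i ω) (fun ω i => D i ω) P) (x : ℝ) (n : ℕ)
    {F : (ℝ × ℝ × ℕ) × ℝ × ℝ → ℝ≥0∞} (hF : Measurable F) :
    ∫⁻ ω, F (state x (fun i => U i ω) (fun i => D i ω) n, U n ω, D n ω) ∂P
      = ∫⁻ ω, ∫⁻ u, ∫⁻ d, F (state x (fun i => U i ω) (fun i => D i ω) n, u, d)
        ∂(expMeasure μ) ∂(expMeasure lam) ∂P := by
  have := isProbabilityMeasure_expMeasure hlam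
  have := isProbabilityMeasure_expMeasure hμ
  have hS : Measurable fun ω => state x (fun i => U i ω) (fun i => D i ω) n :=
    measurable_state x n (fun i _ => hU_meas i) fun i _ => hD_meas i
  have hpair : Measurable fun ω => (U n ω, D n ω) := (hU_meas n).prodMk (hD_meas n)
  have h1 := (indepFun_iff_map_prod_eq_prod_map_map hS.aemeasurable hpair.aemeasurable).mp
    (indepFun_state hU_meas hD_meas hU_indep hD_indep hUD_indep x n)
  have h2 : P.map (fun ω => (U n ω, D n ω)) = (expMeasure lam).prod (expMeasure μ) := by
    rw [← hU_law n, ← hD_law n]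
    exact (indepFun_iff_map_prod_eq_prod_map_map (hU_meas n).aemeasurable
      (hD_meas n).aemeasurable).mp
      (hUD_indep.comp (measurable_pi_apply n) (measurable_pi_apply n))
  rw [← lintegral_map (f := F) hF (hS.prodMk hpair), h1, h2, lintegral_prod _ hF.aemeasurable,
    lintegral_map (by exact hF.lintegral_prod_right') hS]
  refine lintegral_congr fun ω => ?_
  rw [lintegral_prod _ (by fun_prop)]

end Independence

end ElasticTelegraph

/-! ### The potential and its conservation along the legs -/

theorem ae_nonneg_expMeasure (r : ℝ) : ∀ᵐ x ∂(expMeasure r), 0 ≤ x := by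
  have h : {x : ℝ | ¬ 0 ≤ x} = Set.Iio 0 := by ext; simp
  rw [ae_iff, h, ← lintegral_indicator_one measurableSet_Iio, lintegral_expMeasure,
    setLIntegral_congr_fun (g := fun _ => 0) measurableSet_Ioi]
  · simp
  · intro x hx
    have : x ∉ Set.Iio (0 : ℝ) := not_lt.mpr (Set.mem_Ioi.mp hx).le
    simp [this]

theorem lintegral_exp_neg_expMeasure {r s : ℝ} (hr : 0 < r) (hs : 0 ≤ s) :
    ∫⁻ x, ENNReal.ofReal (Real.exp (-(s * x))) ∂(expMeasure r) = ENNReal.ofReal (r / (r + s)) := by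
  rw [lintegral_expMeasure]
  have e : ∀ x, ENNReal.ofReal (r * Real.exp (-(r * x))) * ENNReal.ofReal (Real.exp (-(s * x)))
      = ENNReal.ofReal r * ENNReal.ofReal (Real.exp (-((r + s) * x))) := fun x => by
    rw [← ENNReal.ofReal_mul (by positivity), ← ENNReal.ofReal_mul (by positivity), mul_assoc,
      ← Real.exp_add]
    ring_nf
  simp_rw [e]
  rw [lintegral_const_mul _ (by fun_prop), lintegral_exp_neg_Ioi (by positivity),
    ← ENNReal.ofReal_mul (by positivity)]
  simp [div_eq_mul_inv]

namespace ElasticTelegraph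

/-- The Laplace transform of the remaining time until absorption, discounted by the time elapsed,
on the event that absorption has not happened yet. -/
noncomputable def potential (lam μ α s : ℝ) (q : ℝ × ℝ × ℕ) : ℝ≥0∞ :=
  ENNReal.ofReal (Real.exp (-(s * q.2.1)) * (1 - α) ^ q.2.2 *
    (absorptionLaplace lam μ α s * Real.exp (-(descentRate lam μ s * q.1))))

open Classical in
/-- The conditional contribution of absorption in the `j`-th leg to the Laplace transform of the
absorption time, given the lengths of the periods. -/
noncomputable def legReward (α s : ℝ) (x : ℝ) (u d : ℕ → ℝ) (j : ℕ) : ℝ≥0∞ :=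
  if position x u d j + u j ≤ d j then
    ENNReal.ofReal (Real.exp (-(s * clock x u d (j + 1))) * (α * (1 - α) ^ arrivals x u d j))
  else 0

section

variable {Ω : Type*} [MeasurableSpace Ω] {P : Measure Ω} [IsProbabilityMeasure P]
  {U D : ℕ → Ω → ℝ} {lam μ α s : ℝ}

-- Pathwise bookkeeping that exposes the integrand of `lintegral_downward`, with κ = α + (1−α)g: an
-- arrival is worth α now plus (1−α)g later, and without arrival the equation g = φκ applies.
open Classical in
theorem potential_succ_add_legReward (hα0 : 0 < α) (hα : α ≤ 1) (hμ : 0 < μ) (hl : μ < lam)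
    (hs : 0 ≤ s) (x : ℝ) (u d : ℕ → ℝ) (n : ℕ) :
    potential lam μ α s (state x u d (n + 1)) + legReward α s x u d n
      = ENNReal.ofReal (Real.exp (-(s * (state x u d n).2.1)) * (1 - α) ^ (state x u d n).2.2) *
        (ENNReal.ofReal (Real.exp (-(s * u n))) * ENNReal.ofReal
          (if (state x u d n).1 + u n ≤ d n then
            Real.exp (-(s * ((state x u d n).1 + u n))) *
              (α + (1 - α) * absorptionLaplace lam μ α s)
          else Real.exp (-(s * d n)) *
            (returnLaplace lam μ s * (α + (1 - α) * absorptionLaplace lam μ α s) *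
            Real.exp (-(descentRate lam μ s * ((state x u d n).1 + u n - d n)))))) := by
  have hg := absorptionLaplace_pos hμ hl hα0 hs
  have hα1 : 0 ≤ 1 - α := by linarith
  have hW : legReward α s x u d n = if (state x u d n).1 + u n ≤ d n then
      ENNReal.ofReal (Real.exp (-(s * (state x u d (n + 1)).2.1)) *
        (α * (1 - α) ^ (state x u d n).2.2)) else 0 := rfl
  rw [← absorptionLaplace_eq hμ hl hα0 hs, potential, hW, state_succ]
  generalize state x u d n = q
  obtain ⟨p, c, k⟩ := q
  generalize u n = u
  generalize d n = d
  generalize absorptionLaplace lam μ α s = g at *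
  generalize descentRate lam μ s = r
  by_cases h : p + u ≤ d
  · simp only [if_pos h]
    rw [← ENNReal.ofReal_mul (by positivity), ← ENNReal.ofReal_mul (by positivity),
      ← ENNReal.ofReal_add (by positivity) (by positivity), max_eq_right (by linarith),
      min_eq_right h, mul_add, mul_add, neg_add, neg_add, Real.exp_add, Real.exp_add]
    congr 1
    simp only [mul_zero, neg_zero, Real.exp_zero]
    ring
  · simp only [if_neg h]
    push Not at h
    rw [← ENNReal.ofReal_mul (by positivity), ← ENNReal.ofReal_mul (by positivity), add_zero, max_eq_left (by linarith), min_eq_left h.le, mul_add s, mul_add s, neg_add,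
      neg_add, Real.exp_add, Real.exp_add]
    congr 1
    ring

theorem measurable_state_apply (hU_meas : ∀ i, Measurable (U i)) (hD_meas : ∀ i, Measurable (D i))
    (x : ℝ) (n : ℕ) : Measurable fun ω => state x (fun i => U i ω) (fun i => D i ω) n :=
  measurable_state x n (fun i _ => hU_meas i) fun i _ => hD_meas i

theorem measurable_legReward {T : Type*} [MeasurableSpace T] {u d : T → ℕ → ℝ}
    (hu : ∀ i, Measurable fun t => u t i) (hd : ∀ i, Measurable fun t => d t i) (x : ℝ) (j : ℕ) :
    Measurable fun t => legReward α s x (u t) (d t) j := by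
  have h1 := measurable_state x j (fun i _ => hu i) fun i _ => hd i
  have h2 := measurable_state x (j + 1) (fun i _ => hu i) fun i _ => hd i
  have hc : Measurable fun t => clock x (u t) (d t) (j + 1) := h2.snd.fst
  have hp : Measurable fun t => position x (u t) (d t) j := h1.fst
  have ha : Measurable fun t => arrivals x (u t) (d t) j := h1.snd.snd
  have huj := hu j
  have hdj := hd j
  unfold legReward
  exact Measurable.ite (measurableSet_le (hp.add huj) hdj) (by fun_prop) measurable_const

variable (hμ : 0 < μ) (hl : μ < lam)
  (hU_meas : ∀ i, Measurable (U i)) (hD_meas : ∀ i, Measurable (D i))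
  (hU_law : ∀ i, P.map (U i) = expMeasure lam) (hD_law : ∀ i, P.map (D i) = expMeasure μ)
  (hU_indep : iIndepFun U P) (hD_indep : iIndepFun D P)
  (hUD_indep : IndepFun (fun ω i => U i ω) (fun ω i => D i ω) P)

include hμ hl hU_meas hD_meas hU_law hD_law hU_indep hD_indep hUD_indep

/-- With the state fixed, integrating over the downward period gives κe^{−r(x+u)}, and over the
upward one φκe^{−rx} = g e^{−rx}, which restores the potential. -/
theorem lintegral_potential_succ (hα0 : 0 < α) (hα : α ≤ 1) (hs : 0 ≤ s) {x : ℝ} (hx : 0 ≤ x)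
    (n : ℕ) :
    ∫⁻ ω, potential lam μ α s (state x (fun i => U i ω) (fun i => D i ω) n) ∂P
      = ∫⁻ ω, potential lam μ α s (state x (fun i => U i ω) (fun i => D i ω) (n + 1)) ∂P
        + ∫⁻ ω, legReward α s x (fun i => U i ω) (fun i => D i ω) n ∂P := by
  classical
  have hg := absorptionLaplace_pos hμ hl hα0 hs
  have hα1 : 0 ≤ 1 - α := by linarith
  rw [← lintegral_add_right _ (measurable_legReward hU_meas hD_meas x n)]
  simp_rw [potential_succ_add_legReward hα0 hα hμ hl hs]
  rw [lintegral_state_leg (hμ.trans hl) hμ hU_meas hD_meas hU_law hD_law hU_indep hD_indep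
    hUD_indep x n (F := fun q => ENNReal.ofReal (Real.exp (-(s * q.1.2.1)) * (1 - α) ^ q.1.2.2) *
        (ENNReal.ofReal (Real.exp (-(s * q.2.1))) * ENNReal.ofReal
          (if q.1.1 + q.2.1 ≤ q.2.2 then
            Real.exp (-(s * (q.1.1 + q.2.1))) *
              (α + (1 - α) * absorptionLaplace lam μ α s)
          else Real.exp (-(s * q.2.2)) *
            (returnLaplace lam μ s * (α + (1 - α) * absorptionLaplace lam μ α s) *
            Real.exp (-(descentRate lam μ s * (q.1.1 + q.2.1 - q.2.2))))))) ?_]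
  · refine lintegral_congr fun ω => ?_
    have hp : 0 ≤ (state x (fun i => U i ω) (fun i => D i ω) n).1 := position_nonneg hx _ _ _
    generalize state x (fun i => U i ω) (fun i => D i ω) n = q at *
    have inner : ∀ᵐ u ∂(expMeasure lam), ∫⁻ d,
        ENNReal.ofReal (Real.exp (-(s * q.2.1)) * (1 - α) ^ q.2.2) *
        (ENNReal.ofReal (Real.exp (-(s * u))) * ENNReal.ofReal
          (if q.1 + u ≤ d then
            Real.exp (-(s * (q.1 + u))) * (α + (1 - α) * absorptionLaplace lam μ α s)
          else Real.exp (-(s * d)) *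
            (returnLaplace lam μ s * (α + (1 - α) * absorptionLaplace lam μ α s) *
            Real.exp (-(descentRate lam μ s * (q.1 + u - d)))))) ∂(expMeasure μ)
        = ENNReal.ofReal (Real.exp (-(s * q.2.1)) * (1 - α) ^ q.2.2) *
          ENNReal.ofReal (Real.exp (-(s * u)) * ((α + (1 - α) * absorptionLaplace lam μ α s) *
            Real.exp (-(descentRate lam μ s * (q.1 + u))))) := by
      filter_upwards [ae_nonneg_expMeasure lam] with u hu
      rw [lintegral_const_mul' _ _ ENNReal.ofReal_ne_top,
        lintegral_const_mul' _ _ ENNReal.ofReal_ne_top,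
        lintegral_downward hμ hl hs (by positivity) (by positivity),
        ← ENNReal.ofReal_mul (by positivity)]
    rw [lintegral_congr_ae inner, lintegral_const_mul' _ _ ENNReal.ofReal_ne_top,
      lintegral_upward hμ hl hs (by positivity), ← absorptionLaplace_eq hμ hl hα0 hs, potential,
      ← ENNReal.ofReal_mul (by positivity)]
  · have : Measurable fun q : (ℝ × ℝ × ℕ) × ℝ × ℝ => (if q.1.1 + q.2.1 ≤ q.2.2 then
            Real.exp (-(s * (q.1.1 + q.2.1))) *
              (α + (1 - α) * absorptionLaplace lam μ α s)
          else Real.exp (-(s * q.2.2)) *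
            (returnLaplace lam μ s * (α + (1 - α) * absorptionLaplace lam μ α s) *
            Real.exp (-(descentRate lam μ s * (q.1.1 + q.2.1 - q.2.2))))) :=
      Measurable.ite (measurableSet_le (by fun_prop) (by fun_prop)) (by fun_prop) (by fun_prop)
    fun_prop

/-- Each leg lasts at least as long as its upward period, which contributes a factor λ/(λ+s). -/
theorem lintegral_exp_clock_le (hs : 0 ≤ s) {x : ℝ} (hx : 0 ≤ x) (n : ℕ) :
    ∫⁻ ω, ENNReal.ofReal (Real.exp (-(s * clock x (fun i => U i ω) (fun i => D i ω) n))) ∂P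
      ≤ ENNReal.ofReal (lam / (lam + s)) ^ n := by
  have := isProbabilityMeasure_expMeasure hμ
  induction n with
  | zero => simp [clock]
  | succ n ih =>
    have h := lintegral_state_leg (hμ.trans hl) hμ hU_meas hD_meas hU_law hD_law hU_indep
      hD_indep hUD_indep x n (F := fun q => ENNReal.ofReal
        (Real.exp (-(s * (q.1.2.1 + q.2.1 + min q.2.2 (q.1.1 + q.2.1)))))) (by fun_prop)
    refine h.trans_le ?_
    rw [pow_succ]
    refine le_trans ?_ (mul_le_mul_left ih (ENNReal.ofReal (lam / (lam + s))))
    rw [← lintegral_mul_const' _ _ ENNReal.ofReal_ne_top]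
    refine lintegral_mono fun ω => ?_
    have hp : 0 ≤ (state x (fun i => U i ω) (fun i => D i ω) n).1 := position_nonneg hx _ _ _
    rw [← lintegral_exp_neg_expMeasure (hμ.trans hl) hs,
      ← lintegral_const_mul' _ _ ENNReal.ofReal_ne_top]
    refine lintegral_mono_ae ?_
    filter_upwards [ae_nonneg_expMeasure lam] with u hu
    rw [← ENNReal.ofReal_mul (by positivity), ← Real.exp_add]
    calc _ ≤ ∫⁻ _, ENNReal.ofReal (Real.exp (-(s * clock x (fun i => U i ω) (fun i => D i ω) n)
            + -(s * u))) ∂(expMeasure μ) := by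
          refine lintegral_mono_ae ?_
          filter_upwards [ae_nonneg_expMeasure μ] with d hd
          refine ENNReal.ofReal_le_ofReal (Real.exp_le_exp.mpr ?_)
          have := mul_nonneg hs (le_min hd (add_nonneg hp hu))
          simp only [state] at this ⊢
          linarith
      _ = _ := by simp

/-- Telescope the conservation law from the origin, where the potential is g. The remaining
potential is at most g(λ/(λ+s))^n, which tends to 0 because s > 0. -/
theorem tsum_lintegral_legReward (hα0 : 0 < α) (hα : α ≤ 1) (hs : 0 < s) :
    ∑' j, ∫⁻ ω, legReward α s 0 (fun i => U i ω) (fun i => D i ω) j ∂P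
      = ENNReal.ofReal (absorptionLaplace lam μ α s) := by
  have hg := absorptionLaplace_pos hμ hl hα0 hs.le
  have hα1 : 0 ≤ 1 - α := by linarith
  have hlam := hμ.trans hl
  have hsum : ∀ n, ∫⁻ ω, potential lam μ α s (state 0 (fun i => U i ω) (fun i => D i ω) n) ∂P
      + ∑ j ∈ Finset.range n, ∫⁻ ω, legReward α s 0 (fun i => U i ω) (fun i => D i ω) j ∂P
      = ENNReal.ofReal (absorptionLaplace lam μ α s) := by
    intro n
    induction n with
    | zero => simp [potential, state, position, clock, arrivals]
    | succ n ih =>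
      rw [← ih, lintegral_potential_succ hμ hl hU_meas hD_meas hU_law hD_law hU_indep hD_indep
        hUD_indep hα0 hα hs.le le_rfl n, Finset.sum_range_succ]
      ring
  have hlim : Filter.Tendsto (fun n => ∫⁻ ω, potential lam μ α s
      (state 0 (fun i => U i ω) (fun i => D i ω) n) ∂P) Filter.atTop (nhds 0) := by
    have hlt : ENNReal.ofReal (lam / (lam + s)) < 1 := by
      rw [ENNReal.ofReal_lt_one, div_lt_one (by positivity)]
      linarith
    have h0 := ENNReal.Tendsto.const_mul (a := ENNReal.ofReal (absorptionLaplace lam μ α s))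
      (ENNReal.tendsto_pow_atTop_nhds_zero_of_lt_one hlt) (Or.inr ENNReal.ofReal_ne_top)
    rw [mul_zero] at h0
    refine tendsto_of_tendsto_of_tendsto_of_le_of_le tendsto_const_nhds h0 (fun _ => zero_le)
      fun n => ?_
    refine le_trans ?_ (mul_le_mul_right (lintegral_exp_clock_le hμ hl hU_meas hD_meas hU_law
      hD_law hU_indep hD_indep hUD_indep hs.le le_rfl n) _)
    rw [← lintegral_const_mul' _ _ ENNReal.ofReal_ne_top]
    refine lintegral_mono fun ω => ?_
    rw [potential, ← ENNReal.ofReal_mul hg.le]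
    refine ENNReal.ofReal_le_ofReal ?_
    have hp : 0 ≤ (state 0 (fun i => U i ω) (fun i => D i ω) n).1 :=
      position_nonneg le_rfl _ _ _
    have h1 : Real.exp (-(descentRate lam μ s * (state 0 (fun i => U i ω) (fun i => D i ω) n).1))
        ≤ 1 := Real.exp_le_one_iff.mpr
      (neg_nonpos.mpr (mul_nonneg (descentRate_nonneg hμ hs.le) hp))
    have h2 : (1 - α) ^ (state 0 (fun i => U i ω) (fun i => D i ω) n).2.2 ≤ 1 :=
      pow_le_one₀ hα1 (by linarith)
    refine (mul_le_mul (mul_le_of_le_one_right (Real.exp_pos _).le h2)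
      (mul_le_of_le_one_right hg.le h1) (by positivity) (by positivity)).trans_eq ?_
    rw [mul_comm]
    rfl
  have h3 := hlim.add (ENNReal.tendsto_nat_tsum
    fun j => ∫⁻ ω, legReward α s 0 (fun i => U i ω) (fun i => D i ω) j ∂P)
  simp only [hsum, zero_add] at h3
  exact tendsto_nhds_unique h3 tendsto_const_nhds

end

end ElasticTelegraph

/-! ### Averaging over the decisions -/

/-- The set of the sequences of decisions whose first positive decision has index `m`. -/
def firstTrue (m : ℕ) : Set (ℕ → Bool) := {b | b m = true ∧ ∀ k < m, b k = false}

theorem measurableSet_firstTrue (m : ℕ) : MeasurableSet (firstTrue m) := by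
  have : firstTrue m = (fun b : ℕ → Bool => b m) ⁻¹' {true} ∩
      ⋂ k, ⋂ (_ : k < m), (fun b : ℕ → Bool => b k) ⁻¹' {false} := by
    ext b
    simp [firstTrue]
  rw [this]
  exact (measurable_pi_apply m (measurableSet_singleton _)).inter
    (MeasurableSet.iInter fun k => MeasurableSet.iInter fun _ =>
      measurable_pi_apply k (measurableSet_singleton _))

theorem measure_firstTrue {Ω : Type*} [MeasurableSpace Ω] {P : Measure Ω} [IsProbabilityMeasure P]
    {α : ℝ} (hα0 : 0 ≤ α) (hα : α ≤ 1) {B : ℕ → Ω → Bool} (hB_meas : ∀ k, Measurable (B k))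
    (hB_law : ∀ k, P {ω | B k ω = true} = ENNReal.ofReal α) (hB_indep : iIndepFun B P) (m : ℕ) :
    P {ω | (fun k => B k ω) ∈ firstTrue m} = ENNReal.ofReal (α * (1 - α) ^ m) := by
  have hfalse : ∀ k, P (B k ⁻¹' {false}) = ENNReal.ofReal (1 - α) := fun k => by
    have : B k ⁻¹' {false} = (B k ⁻¹' {true})ᶜ := by ext ω; simp
    rw [this, prob_compl_eq_one_sub (hB_meas k (measurableSet_singleton _)),
      ENNReal.ofReal_sub _ hα0, ENNReal.ofReal_one]
    exact congrArg _ (hB_law k)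
  have h := hB_indep.measure_inter_preimage_eq_mul (Finset.range (m + 1))
    (sets := fun k => if k = m then {true} else {false}) fun k _ => MeasurableSet.of_discrete
  have hset : {ω | (fun k => B k ω) ∈ firstTrue m}
      = ⋂ k ∈ Finset.range (m + 1), B k ⁻¹' (if k = m then {true} else {false}) := by
    ext ω
    simp only [firstTrue, Set.mem_ofPred_eq, Set.mem_iInter, Finset.mem_range, Nat.lt_succ_iff,
      Set.mem_preimage]
    constructor
    · rintro ⟨h1, h2⟩ k hk
      rcases hk.eq_or_lt with rfl | hlt
      · simpa using h1
      · simpa [hlt.ne] using h2 k hlt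
    · intro hk
      exact ⟨by simpa using hk m le_rfl, fun k hlt => by simpa [hlt.ne] using hk k hlt.le⟩
  rw [hset, h, Finset.prod_range_succ, if_pos rfl, Finset.prod_congr rfl
    (g := fun _ => ENNReal.ofReal (1 - α))
    (fun k hk => by rw [if_neg (Finset.mem_range.mp hk).ne, hfalse]), Finset.prod_const,
    Finset.card_range, ENNReal.ofReal_mul hα0, ENNReal.ofReal_pow (by linarith), mul_comm]
  exact congrArg (· * _) (hB_law m)

/-- `exp (-(s * a))` for an extended nonnegative real `a`, with the value `0` at `∞`. -/
noncomputable def expDiscount (s : ℝ) (a : ℝ≥0∞) : ℝ≥0∞ :=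
  if a = ∞ then 0 else ENNReal.ofReal (Real.exp (-(s * a.toReal)))

namespace ElasticTelegraph

section

variable {Ω : Type*} [MeasurableSpace Ω] {P : Measure Ω} [IsProbabilityMeasure P]
  {U D : ℕ → Ω → ℝ} {B : ℕ → Ω → Bool} {lam μ α s : ℝ}

theorem measurableSet_absorbedAt (hU_meas : ∀ i, Measurable (U i))
    (hD_meas : ∀ i, Measurable (D i)) (hB_meas : ∀ k, Measurable (B k)) (x : ℝ) (j : ℕ) :
    MeasurableSet {ω | AbsorbedAt x (fun i => U i ω) (fun i => D i ω) (fun k => B k ω) j} := by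
  have h1 := measurable_state_apply hU_meas hD_meas x j
  have : {ω | AbsorbedAt x (fun i => U i ω) (fun i => D i ω) (fun k => B k ω) j}
      = {ω | (state x (fun i => U i ω) (fun i => D i ω) j).1 + U j ω ≤ D j ω} ∩
        ⋃ m, {ω | (state x (fun i => U i ω) (fun i => D i ω) j).2.2 = m} ∩
          {ω | (fun k => B k ω) ∈ firstTrue m} := by
    ext ω
    simp [absorbedAt_iff, state, firstTrue, Arrives]
  rw [this]
  refine (measurableSet_le (h1.fst.add (hU_meas j)) (hD_meas j)).inter
    (MeasurableSet.iUnion fun m => MeasurableSet.inter ?_ ?_)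
  · exact h1.snd.snd (measurableSet_singleton m)
  · exact (measurable_pi_lambda _ hB_meas) (measurableSet_firstTrue m)

theorem measurable_absorptionTime (hU_meas : ∀ i, Measurable (U i))
    (hD_meas : ∀ i, Measurable (D i)) (hB_meas : ∀ k, Measurable (B k)) (x : ℝ) :
    Measurable fun ω => absorptionTime x (fun i => U i ω) (fun i => D i ω) (fun k => B k ω) := by
  classical
  have : (fun ω => absorptionTime x (fun i => U i ω) (fun i => D i ω) (fun k => B k ω))
      = fun ω => ⨅ j, if AbsorbedAt x (fun i => U i ω) (fun i => D i ω) (fun k => B k ω) j then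
        ENNReal.ofReal (clock x (fun i => U i ω) (fun i => D i ω) (j + 1)) else ⊤ := by
    ext ω
    simp only [absorptionTime, iInf_eq_if]
  rw [this]
  refine Measurable.iInf fun j => Measurable.ite
    (measurableSet_absorbedAt hU_meas hD_meas hB_meas x j) ?_ measurable_const
  exact (measurable_state_apply hU_meas hD_meas x (j + 1)).snd.fst.ennreal_ofReal

-- Split according to the number m of earlier arrivals. Each piece is a function of the periods
-- times the indicator that the first positive decision is the m-th, and independence replaces the
-- indicator by α(1−α)^m.
open Classical in
theorem lintegral_absorbedAt (hα0 : 0 ≤ α) (hα : α ≤ 1)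
    (hU_meas : ∀ i, Measurable (U i)) (hD_meas : ∀ i, Measurable (D i))
    (hB_meas : ∀ k, Measurable (B k))
    (hB_law : ∀ k, P {ω | B k ω = true} = ENNReal.ofReal α) (hB_indep : iIndepFun B P)
    (hUDB_indep : IndepFun (fun ω => ((fun i => U i ω), (fun i => D i ω)))
      (fun ω k => B k ω) P) (x : ℝ) (j : ℕ) :
    ∫⁻ ω, (if AbsorbedAt x (fun i => U i ω) (fun i => D i ω) (fun k => B k ω) j then
      ENNReal.ofReal (Real.exp (-(s * clock x (fun i => U i ω) (fun i => D i ω) (j + 1))))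
      else 0) ∂P = ∫⁻ ω, legReward α s x (fun i => U i ω) (fun i => D i ω) j ∂P := by
  let f : ℕ → (ℕ → ℝ) × (ℕ → ℝ) → ℝ≥0∞ := fun m p =>
    if (state x p.1 p.2 j).1 + p.1 j ≤ p.2 j ∧ (state x p.1 p.2 j).2.2 = m then
      ENNReal.ofReal (Real.exp (-(s * (state x p.1 p.2 (j + 1)).2.1))) else 0
  let e : ℕ → (ℕ → Bool) → ℝ≥0∞ := fun m => (firstTrue m).indicator 1
  have hstate : ∀ n, Measurable fun p : (ℕ → ℝ) × (ℕ → ℝ) => state x p.1 p.2 n := fun n =>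
    measurable_state x n (fun i _ => (measurable_pi_apply i).comp measurable_fst)
      fun i _ => (measurable_pi_apply i).comp measurable_snd
  have hf : ∀ m, Measurable (f m) := fun m => by
    have hle : MeasurableSet {p : (ℕ → ℝ) × (ℕ → ℝ) | (state x p.1 p.2 j).1 + p.1 j ≤ p.2 j} :=
      measurableSet_le ((hstate j).fst.add ((measurable_pi_apply j).comp measurable_fst))
        ((measurable_pi_apply j).comp measurable_snd)
    have heq : MeasurableSet {p : (ℕ → ℝ) × (ℕ → ℝ) | (state x p.1 p.2 j).2.2 = m} :=
      (hstate j).snd.snd (measurableSet_singleton m)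
    refine Measurable.ite (hle.inter heq) ?_ measurable_const
    exact ((hstate (j + 1)).snd.fst.const_mul s).neg.exp.ennreal_ofReal
  have he : ∀ m, Measurable (e m) := fun m =>
    measurable_one.indicator (measurableSet_firstTrue m)
  have hUD : Measurable fun ω => ((fun i => U i ω), (fun i => D i ω)) :=
    (measurable_pi_lambda _ hU_meas).prodMk (measurable_pi_lambda _ hD_meas)
  have hB : Measurable fun ω k => B k ω := measurable_pi_lambda _ hB_meas
  have habs : ∀ ω, AbsorbedAt x (fun i => U i ω) (fun i => D i ω) (fun k => B k ω) j ↔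
      (state x (fun i => U i ω) (fun i => D i ω) j).1 + U j ω ≤ D j ω ∧
        (fun k => B k ω) ∈ firstTrue (state x (fun i => U i ω) (fun i => D i ω) j).2.2 :=
    fun ω => absorbedAt_iff _ _ _ _ _
  have h1 : ∀ ω, (if AbsorbedAt x (fun i => U i ω) (fun i => D i ω) (fun k => B k ω) j then
      ENNReal.ofReal (Real.exp (-(s * clock x (fun i => U i ω) (fun i => D i ω) (j + 1)))) else 0)
      = ∑' m, f m ((fun i => U i ω), (fun i => D i ω)) * e m (fun k => B k ω) := fun ω => by
    rw [tsum_eq_single (state x (fun i => U i ω) (fun i => D i ω) j).2.2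
      fun m hm => by simp [f, hm.symm]]
    by_cases ha : (state x (fun i => U i ω) (fun i => D i ω) j).1 + U j ω ≤ D j ω
    · by_cases hb : (fun k => B k ω) ∈ firstTrue (state x (fun i => U i ω) (fun i => D i ω) j).2.2
      · rw [if_pos ((habs ω).mpr ⟨ha, hb⟩)]
        rw [show e _ (fun k => B k ω) = 1 from Set.indicator_of_mem hb 1, mul_one]
        exact (if_pos ⟨ha, rfl⟩).symm
      · rw [if_neg fun h => hb ((habs ω).mp h).2]
        simp [e, Set.indicator_of_notMem hb]
    · rw [if_neg fun h => ha ((habs ω).mp h).1]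
      simp [f, ha]
  have h2 : ∀ ω, legReward α s x (fun i => U i ω) (fun i => D i ω) j
      = ∑' m, f m ((fun i => U i ω), (fun i => D i ω)) * ENNReal.ofReal (α * (1 - α) ^ m) :=
    fun ω => by
    rw [tsum_eq_single (state x (fun i => U i ω) (fun i => D i ω) j).2.2
      fun m hm => by simp [f, hm.symm]]
    by_cases ha : (state x (fun i => U i ω) (fun i => D i ω) j).1 + U j ω ≤ D j ω
    · have ha' : position x (fun i => U i ω) (fun i => D i ω) j + U j ω ≤ D j ω := ha
      simp only [f, legReward, state, ha', true_and, if_true]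
      rw [← ENNReal.ofReal_mul (by positivity)]
    · have ha' : ¬ position x (fun i => U i ω) (fun i => D i ω) j + U j ω ≤ D j ω := ha
      simp [f, legReward, ha, ha']
  simp_rw [h1, h2]
  have hfU : ∀ m, Measurable fun ω => f m ((fun i => U i ω), (fun i => D i ω)) :=
    fun m => (hf m).comp hUD
  have heB : ∀ m, Measurable fun ω => e m (fun k => B k ω) := fun m => (he m).comp hB
  have hfe : ∀ m, Measurable fun ω =>
      f m ((fun i => U i ω), (fun i => D i ω)) * e m (fun k => B k ω) :=
    fun m => (hfU m).mul (heB m)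
  rw [lintegral_tsum fun m => (hfe m).aemeasurable,
    lintegral_tsum fun m => ((hfU m).mul_const _).aemeasurable]
  refine tsum_congr fun m => ?_
  have hind := lintegral_mul_eq_lintegral_mul_lintegral_of_indepFun ((hf m).comp hUD)
    ((he m).comp hB) (hUDB_indep.comp (hf m) (he m))
  have hE : ∫⁻ ω, e m (fun k => B k ω) ∂P = ENNReal.ofReal (α * (1 - α) ^ m) := by
    rw [← measure_firstTrue hα0 hα hB_meas hB_law hB_indep m]
    exact lintegral_indicator_one (hB (measurableSet_firstTrue m))
  refine hind.trans ?_
  rw [lintegral_mul_const _ (hfU m), ← hE]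
  rfl

open Classical in
theorem expDiscount_absorptionTime {u d : ℕ → ℝ} {b : ℕ → Bool} {x : ℝ} (hx : 0 ≤ x)
    (hu : ∀ i, 0 ≤ u i) (hd : ∀ i, 0 ≤ d i) (s : ℝ) :
    expDiscount s (absorptionTime x u d b)
      = ∑' j, if AbsorbedAt x u d b j then
        ENNReal.ofReal (Real.exp (-(s * clock x u d (j + 1)))) else 0 := by
  by_cases h : ∃ j, AbsorbedAt x u d b j
  · obtain ⟨j, hj⟩ := h
    rw [tsum_eq_single j fun i hi => if_neg fun h => hi (h.unique hj), if_pos hj,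
      hj.absorptionTime_eq, expDiscount, if_neg ENNReal.ofReal_ne_top,
      ENNReal.toReal_ofReal (clock_nonneg hx hu hd _)]
  · push Not at h
    have : absorptionTime x u d b = ∞ := by simp [absorptionTime, h]
    simp [this, expDiscount, h]

theorem lintegral_expDiscount_absorptionTime (hμ : 0 < μ) (hl : μ < lam)
    (hα0 : 0 < α) (hα : α ≤ 1) (hs : 0 < s)
    (hU_meas : ∀ i, Measurable (U i)) (hD_meas : ∀ i, Measurable (D i))
    (hB_meas : ∀ k, Measurable (B k))
    (hU_law : ∀ i, P.map (U i) = expMeasure lam) (hD_law : ∀ i, P.map (D i) = expMeasure μ)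
    (hB_law : ∀ k, P {ω | B k ω = true} = ENNReal.ofReal α)
    (hU_indep : iIndepFun U P) (hD_indep : iIndepFun D P) (hB_indep : iIndepFun B P)
    (hUD_indep : IndepFun (fun ω i => U i ω) (fun ω i => D i ω) P)
    (hUDB_indep : IndepFun (fun ω => ((fun i => U i ω), (fun i => D i ω)))
      (fun ω k => B k ω) P) :
    ∫⁻ ω, expDiscount s (absorptionTime 0 (fun i => U i ω) (fun i => D i ω) (fun k => B k ω)) ∂P
      = ENNReal.ofReal (absorptionLaplace lam μ α s) := by
  classical
  have hnonneg : ∀ {r : ℝ} {X : Ω → ℝ}, Measurable X → P.map X = expMeasure r →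
      ∀ᵐ ω ∂P, 0 ≤ X ω := fun {r X} hX hlaw =>
    ae_of_ae_map hX.aemeasurable (hlaw ▸ ae_nonneg_expMeasure r)
  have hae : ∀ᵐ ω ∂P,
      expDiscount s (absorptionTime 0 (fun i => U i ω) (fun i => D i ω) (fun k => B k ω))
      = ∑' j, if AbsorbedAt 0 (fun i => U i ω) (fun i => D i ω) (fun k => B k ω) j then
        ENNReal.ofReal (Real.exp (-(s * clock 0 (fun i => U i ω) (fun i => D i ω) (j + 1))))
        else 0 := by
    -- The periods are nonnegative only almost surely; nonnegativity is needed for `ENNReal.ofReal`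
    -- not to truncate the clock.
    filter_upwards [ae_all_iff.mpr fun i => hnonneg (hU_meas i) (hU_law i),
      ae_all_iff.mpr fun i => hnonneg (hD_meas i) (hD_law i)] with ω hu hd
    exact expDiscount_absorptionTime le_rfl hu hd s
  rw [lintegral_congr_ae hae, lintegral_tsum, ← tsum_lintegral_legReward hμ hl hU_meas hD_meas
    hU_law hD_law hU_indep hD_indep hUD_indep hα0 hα hs]
  · exact tsum_congr fun j => lintegral_absorbedAt hα0.le hα hU_meas hD_meas hB_meas hB_law
      hB_indep hUDB_indep 0 j
  · intro j
    have hc := (measurable_state_apply hU_meas hD_meas 0 (j + 1)).snd.fst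
    refine (Measurable.ite (measurableSet_absorbedAt hU_meas hD_meas hB_meas 0 j) ?_
      measurable_const).aemeasurable
    exact (hc.const_mul s).neg.exp.ennreal_ofReal

end

end ElasticTelegraph

/-! ### Uniqueness of the Laplace transform -/

open scoped NNReal in
/-- A finite measure on `[0, ∞)` is determined by its Laplace transform at the natural numbers. -/
theorem MeasureTheory.Measure.ext_of_lintegral_exp_neg_nat {ν ν' : Measure ℝ} [IsFiniteMeasure ν]
    [IsFiniteMeasure ν'] (hν : ∀ᵐ x ∂ν, 0 ≤ x) (hν' : ∀ᵐ x ∂ν', 0 ≤ x)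
    (h : ∀ n : ℕ, ∫⁻ x, ENNReal.ofReal (Real.exp (-(n * x))) ∂ν
      = ∫⁻ x, ENNReal.ofReal (Real.exp (-(n * x))) ∂ν') : ν = ν' := by
  have hback : ∀ {ρ : Measure ℝ}, (∀ᵐ x ∂ρ, 0 ≤ x) →
      (ρ.map Real.toNNReal).map ((↑) : ℝ≥0 → ℝ) = ρ := fun {ρ} hρ => by
    rw [Measure.map_map (by fun_prop) (by fun_prop)]
    conv_rhs => rw [← Measure.map_id (μ := ρ)]
    refine Measure.map_congr ?_
    filter_upwards [hρ] with x hx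
    simp [hx]
  -- On the half-line e^{−x} is bounded, which it is not on ℝ.
  suffices ν.map Real.toNNReal = ν'.map Real.toNNReal by
    rw [← hback hν, ← hback hν', this]
  let f : BoundedContinuousFunction ℝ≥0 ℝ :=
    BoundedContinuousFunction.ofNormedAddCommGroup (fun x : ℝ≥0 => Real.exp (-(x : ℝ)))
      (by fun_prop) 1 fun x => by
        rw [Real.norm_of_nonneg (Real.exp_pos _).le]
        exact Real.exp_le_one_iff.mpr (neg_nonpos.mpr x.2)
  have hf0 : ∀ x, 0 ≤ f x := fun x => (Real.exp_pos _).le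
  -- The polynomials in e^{−x} form an algebra that separates points, and their integrals are
  -- combinations of the transforms at natural numbers.
  let A : StarSubalgebra ℝ (BoundedContinuousFunction ℝ≥0 ℝ) :=
    { (Polynomial.aeval (R := ℝ) f).range with
      star_mem' := fun {a} ha => by
        have : star a = a := by ext x; simp
        rwa [this] }
  refine ext_of_forall_mem_subalgebra_integral_eq_of_pseudoEMetric_complete_countable
    (𝕜 := ℝ) (A := A) ?_ ?_
  · intro x y hxy
    refine ⟨fun t => f t, ⟨(f : C(ℝ≥0, ℝ)), ?_, rfl⟩, fun hf => hxy ?_⟩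
    · exact ⟨f, ⟨Polynomial.X, by simp⟩, rfl⟩
    · have : Real.exp (-(x : ℝ)) = Real.exp (-(y : ℝ)) := hf
      exact NNReal.coe_injective (neg_injective (Real.exp_injective this))
  · rintro g ⟨p, rfl⟩
    have hpow : ∀ (n : ℕ) {ρ : Measure ℝ} (_ : ∀ᵐ x ∂ρ, 0 ≤ x),
        ∫ x, f x ^ n ∂(ρ.map Real.toNNReal)
          = (∫⁻ x, ENNReal.ofReal (Real.exp (-(n * x))) ∂ρ).toReal := fun n {ρ} hρ => by
      rw [integral_map (by fun_prop) (by fun_prop), integral_eq_lintegral_of_nonneg_ae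
        (Filter.Eventually.of_forall fun x => pow_nonneg (hf0 _) n) (by fun_prop)]
      refine congrArg _ (lintegral_congr_ae ?_)
      filter_upwards [hρ] with x hx
      have hfx : f x.toNNReal = Real.exp (-x) :=
        congrArg (fun t => Real.exp (-t)) (Real.coe_toNNReal x hx)
      rw [hfx, ← Real.exp_nat_mul, mul_neg]
    have hint : ∀ {ρ : Measure ℝ≥0} [IsFiniteMeasure ρ],
        ∫ x, (Polynomial.aeval f p) x ∂ρ = ∑ n ∈ Finset.range (p.natDegree + 1), p.coeff n * ∫ x, f x ^ n ∂ρ := by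
      intro ρ _
      have e : ∀ x, (Polynomial.aeval f p) x = ∑ n ∈ Finset.range (p.natDegree + 1), p.coeff n * f x ^ n := fun x => by
        rw [Polynomial.aeval_eq_sum_range]
        simp
      simp_rw [e]
      have hi : ∀ n, Integrable (fun x => f x ^ n) ρ := fun n => (f ^ n).integrable ρ
      rw [integral_finsetSum _ fun n _ => (hi n).const_mul _]
      simp_rw [integral_const_mul]
    refine hint.trans (Eq.trans ?_ hint.symm)
    refine Finset.sum_congr rfl fun n _ => ?_
    rw [hpow n hν, hpow n hν', h n]

/-! ### From the transform to the law and its distribution function -/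

theorem absorptionLaplace_zero {lam μ α : ℝ} (hμ : 0 < μ) (hl : μ < lam) (hα0 : 0 < α) :
    absorptionLaplace lam μ α 0 = 1 := by
  rw [absorptionLaplace, returnLaplace_zero hμ hl]
  rw [mul_one, mul_one, sub_sub_cancel, div_self hα0.ne']

theorem tendsto_absorptionLaplace {lam μ α : ℝ} (hμ : 0 < μ) (hl : μ < lam) (hα0 : 0 < α) :
    Filter.Tendsto (absorptionLaplace lam μ α) (nhdsWithin 0 (Set.Ioi 0)) (nhds 1) := by
  have h : ContinuousAt (absorptionLaplace lam μ α) 0 := by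
    refine ContinuousAt.div ?_ ?_ (absorptionLaplace_denom_pos hμ hl hα0 le_rfl).ne'
    · exact (continuous_returnLaplace.const_mul α).continuousAt
    · exact (continuous_const.sub (continuous_returnLaplace.const_mul _)).continuousAt
  rw [ContinuousAt, absorptionLaplace_zero hμ hl hα0] at h
  exact h.mono_left nhdsWithin_le_nhds

/-- A random variable with values in `[0, ∞]` whose Laplace transform is `absorptionLaplace` is
almost surely finite, and its law is given by `absorptionDensity`. -/
theorem ae_lt_top_and_map_eq_of_expDiscount {Ω : Type*} [MeasurableSpace Ω] {P : Measure Ω}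
    [IsProbabilityMeasure P] {lam μ α : ℝ} (hμ : 0 < μ) (hl : μ < lam) (hα0 : 0 < α) (hα : α ≤ 1)
    {A : Ω → ℝ≥0∞} (hA : Measurable A)
    (h : ∀ s, 0 < s → ∫⁻ ω, expDiscount s (A ω) ∂P = ENNReal.ofReal (absorptionLaplace lam μ α s)) :
    (∀ᵐ ω ∂P, A ω < ∞) ∧ P.map (fun ω => (A ω).toReal) = (volume.restrict (Set.Ioi 0)).withDensity
      fun y => ENNReal.ofReal (absorptionDensity lam μ α y) := by
  have hlam := hμ.trans hl
  have hfin : ∀ᵐ ω ∂P, A ω < ∞ := by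
    have hset : MeasurableSet {ω | A ω < ∞} := measurableSet_lt hA measurable_const
    have hle : 1 ≤ P {ω | A ω < ∞} := by
      -- For s > 0 the discount is at most the indicator of finiteness, while its mean tends to 1 as
      -- s → 0.
      have hlim := ENNReal.tendsto_ofReal (tendsto_absorptionLaplace hμ hl hα0)
      rw [ENNReal.ofReal_one] at hlim
      refine le_of_tendsto hlim ?_
      filter_upwards [self_mem_nhdsWithin] with s hs
      rw [← h s hs, ← lintegral_indicator_one hset]
      refine lintegral_mono fun ω => ?_
      rcases eq_or_ne (A ω) ∞ with hω | hω
      · simp [expDiscount, hω]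
      · rw [expDiscount, if_neg hω, Set.indicator_of_mem (show ω ∈ {ω | A ω < ∞} from hω.lt_top)]
        refine ENNReal.ofReal_le_one.mpr (Real.exp_le_one_iff.mpr (neg_nonpos.mpr ?_))
        exact mul_nonneg (Set.mem_Ioi.mp hs).le ENNReal.toReal_nonneg
    exact (mem_ae_iff_prob_eq_one hset).mpr (le_antisymm prob_le_one hle)
  refine ⟨hfin, ?_⟩
  have hdens : AEMeasurable (fun y => ENNReal.ofReal (absorptionDensity lam μ α y))
      (volume.restrict (Set.Ioi 0)) :=
    ((continuousOn_absorptionDensity hlam hμ hα0.le hα).aemeasurable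
      measurableSet_Ioi).ennreal_ofReal
  have hlap : ∀ n : ℕ, ∫⁻ y, ENNReal.ofReal (Real.exp (-(n * y)))
      ∂((volume.restrict (Set.Ioi 0)).withDensity
        fun y => ENNReal.ofReal (absorptionDensity lam μ α y))
      = ENNReal.ofReal (absorptionLaplace lam μ α n) := fun n => by
    rw [lintegral_withDensity_eq_lintegral_mul₀ hdens (by fun_prop),
      ← lintegral_exp_mul_absorptionDensity hμ hl hα0 hα n.cast_nonneg]
    refine setLIntegral_congr_fun measurableSet_Ioi fun y _ => ?_
    rw [Pi.mul_apply, mul_comm, ← ENNReal.ofReal_mul (Real.exp_pos _).le]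
  have hmass : IsFiniteMeasure ((volume.restrict (Set.Ioi 0)).withDensity
      fun y => ENNReal.ofReal (absorptionDensity lam μ α y)) := by
    refine ⟨?_⟩
    have h0 := hlap 0
    simp only [Nat.cast_zero, zero_mul, neg_zero, Real.exp_zero, ENNReal.ofReal_one,
      lintegral_one] at h0
    rw [h0]
    exact ENNReal.ofReal_lt_top
  have hAm : Measurable fun ω => (A ω).toReal := hA.ennreal_toReal
  have := Measure.isProbabilityMeasure_map (μ := P) hAm.aemeasurable
  refine Measure.ext_of_lintegral_exp_neg_nat ?_ ?_ fun n => ?_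
  · exact (ae_map_iff hAm.aemeasurable measurableSet_Ici).mpr
      (Filter.Eventually.of_forall fun ω => ENNReal.toReal_nonneg)
  · refine (withDensity_absolutelyContinuous _ _).ae_le ?_
    filter_upwards [self_mem_ae_restrict measurableSet_Ioi] with y hy
    exact (Set.mem_Ioi.mp hy).le
  · rw [hlap, lintegral_map (by fun_prop) hAm]
    cases n with
    -- The transform hypothesis covers only s > 0; at n = 0 both sides are the total mass 1.
    | zero => simp [absorptionLaplace_zero hμ hl hα0]
    | succ n =>
      rw [← h _ (by positivity)]
      refine lintegral_congr_ae ?_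
      filter_upwards [hfin] with ω hω
      rw [expDiscount, if_neg hω.ne]

theorem hasDerivAt_measureReal_Iic {f : ℝ → ℝ} (hf : ContinuousOn f (Set.Ioi 0))
    (hf0 : ∀ y, 0 < y → 0 ≤ f y) {ν : Measure ℝ} [IsFiniteMeasure ν]
    (hν : ν = (volume.restrict (Set.Ioi 0)).withDensity fun y => ENNReal.ofReal (f y))
    {y : ℝ} (hy : 0 < y) : HasDerivAt (fun t => ν.real (Set.Iic t)) (f y) y := by
  have hy2 : 0 < y / 2 := by linarith
  have hcont : ∀ t, 0 < t → ContinuousOn f (Set.uIcc (y / 2) t) := fun t ht =>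
    hf.mono fun x hx => (lt_min hy2 ht).trans_le hx.1
  -- Starting the integral at y/2 keeps it where f is continuous, away from 0.
  have hF : HasDerivAt (fun t => ν.real (Set.Iic (y / 2)) + ∫ x in (y / 2)..t, f x) (f y) y := by
    refine (intervalIntegral.integral_hasDerivAt_right (hcont y hy).intervalIntegrable ?_
      (hf.continuousAt (Ioi_mem_nhds hy))).const_add _
    exact hf.stronglyMeasurableAtFilter isOpen_Ioi y hy
  refine hF.congr_of_eventuallyEq ?_
  filter_upwards [Ioi_mem_nhds (show y / 2 < y by linarith)] with t ht
  have ht' : y / 2 ≤ t := (Set.mem_Ioi.mp ht).le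
  rw [← Set.Iic_union_Ioc_eq_Iic ht', measureReal_union
    (Set.Iic_disjoint_Ioc le_rfl) measurableSet_Ioc,
    intervalIntegral.integral_of_le ht']
  congr 1
  have hsub : Set.Ioc (y / 2) t ⊆ Set.Ioi 0 := fun x hx => hy2.trans hx.1
  rw [measureReal_def, hν, withDensity_apply _ measurableSet_Ioc,
    Measure.restrict_restrict measurableSet_Ioc, Set.inter_eq_left.mpr hsub,
    integral_eq_lintegral_of_nonneg_ae]
  · filter_upwards [self_mem_ae_restrict measurableSet_Ioc] with x hx
    exact hf0 x (hsub hx)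
  · exact (hf.mono hsub).aestronglyMeasurable measurableSet_Ioc

theorem mainTheorem1 {Ω : Type*} [MeasurableSpace Ω] (P : Measure Ω) [IsProbabilityMeasure P]
    (lam μ α : ℝ) (hμ : 0 < μ) (hμlam : μ < lam) (hα0 : 0 < α) (hα1 : α < 1)
    (U D : ℕ → Ω → ℝ) (B : ℕ → Ω → Bool)
    (hU_meas : ∀ i, Measurable (U i)) (hD_meas : ∀ i, Measurable (D i))
    (hB_meas : ∀ k, Measurable (B k))
    -- exponential upward periods with rate `lam` and downward periods with rate `μ`;
    -- each arrival at the origin leads to absorption with probability `α`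
    (hU_law : ∀ i, P.map (U i) = expMeasure lam)
    (hD_law : ∀ i, P.map (D i) = expMeasure μ)
    (hB_law : ∀ k, P {ω | B k ω = true} = ENNReal.ofReal α)
    -- all these random variables are mutually independent
    (hU_indep : iIndepFun U P) (hD_indep : iIndepFun D P) (hB_indep : iIndepFun B P)
    (hUD_indep : IndepFun (fun ω i => U i ω) (fun ω i => D i ω) P)
    (hUDB_indep : IndepFun (fun ω => ((fun i => U i ω), (fun i => D i ω)))
      (fun ω k => B k ω) P)
    -- the absorption time of the motion started at the origin
    (A : Ω → ℝ≥0∞)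
    (hA : ∀ ω, A ω = ElasticTelegraph.absorptionTime 0
      (fun i => U i ω) (fun i => D i ω) (fun k => B k ω)) :
    -- absorption occurs almost surely
    (∀ᵐ ω ∂P, A ω < ∞) ∧
    -- all the series in the formula converge
    (∀ y : ℝ, 0 < y →
      (Summable fun k : ℕ => ((y * Real.sqrt (lam * μ)) ^ 2 / 4) ^ k /
        ((k.factorial : ℝ) * (k + 1).factorial)) ∧
      (∀ m : ℕ, 2 ≤ m →
        Summable (hyp1F2Term (((m : ℝ) - 1) / 2) (((m : ℝ) + 1) / 2) m
          (lam * μ * y ^ 2 / 4)) ∧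
        Summable (hyp1F2Term (((m : ℝ) - 1) / 2) (((m : ℝ) + 1) / 2) ((m : ℝ) + 1)
          (lam * μ * y ^ 2 / 4))) ∧
      Summable fun k : ℕ => absorptionSeriesTerm lam μ α y (k + 2)) ∧
    -- the absorption time has the asserted density, which is concentrated on `(0, ∞)`
    HasPDF (fun ω => (A ω).toReal) P ∧
    pdf (fun ω => (A ω).toReal) P =ᵐ[volume]
      (Set.Ioi 0).indicator (fun y => ENNReal.ofReal (absorptionDensity lam μ α y)) ∧
    -- and at every `y > 0` it is the derivative of the distribution function
    (∀ y : ℝ, 0 < y →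
      HasDerivAt (fun t : ℝ => P.real {ω | A ω ≤ ENNReal.ofReal t})
        (absorptionDensity lam μ α y) y) := by
  have hlam : 0 < lam := hμ.trans hμlam
  have hA_meas : Measurable A := by
    rw [funext hA]
    exact ElasticTelegraph.measurable_absorptionTime hU_meas hD_meas hB_meas 0
  obtain ⟨hfin, hmap⟩ := ae_lt_top_and_map_eq_of_expDiscount hμ hμlam hα0 hα1.le hA_meas
    fun s hs => by
      simp_rw [hA]
      exact ElasticTelegraph.lintegral_expDiscount_absorptionTime hμ hμlam hα0 hα1.le hs hU_meas
        hD_meas hB_meas hU_law hD_law hB_law hU_indep hD_indep hB_indep hUD_indep hUDB_indep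
  have hAm : Measurable fun ω => (A ω).toReal := hA_meas.ennreal_toReal
  have hcont := continuousOn_absorptionDensity hlam hμ hα0.le hα1.le
  have hdens : AEMeasurable ((Set.Ioi 0).indicator fun y =>
      ENNReal.ofReal (absorptionDensity lam μ α y)) volume :=
    (aemeasurable_indicator_iff measurableSet_Ioi).mpr
      (hcont.aemeasurable measurableSet_Ioi).ennreal_ofReal
  have hmap' := hmap
  rw [← withDensity_indicator measurableSet_Ioi] at hmap'
  have hpdf : HasPDF (fun ω => (A ω).toReal) P :=
    hasPDF_of_map_eq_withDensity hAm.aemeasurable _ hdens hmap'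
  refine ⟨hfin, fun y hy => ⟨?_, fun m hm => ?_, ?_⟩, hpdf, ?_, fun y hy => ?_⟩
  · exact summable_pow_div_factorial_mul_factorial 1 (by positivity)
  · have hm' : (2 : ℝ) ≤ m := by exact_mod_cast hm
    rw [show ((m : ℝ) + 1) / 2 = ((m : ℝ) - 1) / 2 + 1 by ring]
    exact ⟨summable_hyp1F2Term (by linarith) (by linarith),
      summable_hyp1F2Term (by linarith) (by linarith)⟩
  · exact summable_absorptionSeriesTerm hlam.le hμ.le hα0.le hα1.le hy.le
  · exact (pdf.eq_of_map_eq_withDensity _ hdens).mp hmap'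
  · have := Measure.isProbabilityMeasure_map (μ := P) hAm.aemeasurable
    refine (hasDerivAt_measureReal_Iic hcont
      (fun y hy => absorptionDensity_nonneg hlam hμ hα0.le hα1.le hy) hmap
      hy).congr_of_eventuallyEq ?_
    filter_upwards [Ioi_mem_nhds hy] with t ht
    rw [measureReal_def, measureReal_def, Measure.map_apply hAm measurableSet_Iic]
    refine congrArg _ (measure_congr ?_)
    -- The two events can differ only where A = ∞, since `toReal` sends ∞ to 0; this set is null.
    filter_upwards [hfin] with ω hω
    exact propext (ENNReal.le_ofReal_iff_toReal_le hω.ne (Set.mem_Ioi.mp ht).le)
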